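/- Let $n\ge 3$ and consider $\pm1$-valued observables $A_i,B_i$ ($1\le i\le n$) and $N_{ij}=N_{ji}$ ($i\ne j$). A quantum realization consists of a complex Hilbert space $\mathcal H$ of arbitrary dimension, a unit vector $|\psi\rangle\in\mathcal H$, and bounded self-adjoint operators $A_i,B_i,N_{ij}$ on $\mathcal H$ whose squares are $\mathbb 1$; no commutation relation is assumed. For a sequence $M_1\to\dots\to M_r$ of such observables, $\langle M_1\cdots M_r\rangle_{\rm seq}$ is the expected product of the outcomes when they are measured projectively, one after the other, on $|\psi\rangle$: $$\langle M_1\cdots M_r\rangle_{\rm seq}=\sum_{m_1,\dots,m_r=\pm1}m_1\cdots m_r\,\Big\|\tfrac{\mathbb 1+m_rM_r}{2}\cdots\tfrac{\mathbb 1+m_1M_1}{2}|\psi\rangle\Big\|^2=\tfrac1{2^{r-1}}\langle\psi|\{M_1,\{M_2,\dots,\{M_{r-1},M_r\}\}\}|\psi\rangle .$$ For a finite set of measurements, $\langle M_1\cdots M_r\rangle_\pi$ is the average of $\langle M_{\sigma(1)}\cdots M_{\sigma(r)}\rangle_{\rm seq}$ over a set of orders $\sigma$, fixed once and for all for each correlator,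 such that each of the $r!$ products $M_{\tau(1)}\cdots M_{\tau(r)}$ occurs when the corresponding nested anticommutators are expanded; any such choice is allowed. Put $\alpha_n=\binom{n-1}{2}$ and $$T_n=(n-2)\sum_{\{i,j\}}\Big\langle A_iA_jN_{ij}\prod_{k\ne i,j}B_k\Big\rangle_\pi+\alpha_n\sum_i\Big\langle A_i\prod_{k\ne i}B_k\Big\rangle_\pi-\sum_{\{i,j,k\}}\Big\langle A_iA_jA_k\prod_{l\ne i,j,k}B_l\Big\rangle_\pi+\sum_{\{i,j,k\}}\big(\langle N_{ij}N_{jk}\rangle_\pi+\langle N_{jk}N_{ki}\rangle_\pi+\langle N_{ki}N_{ij}\rangle_\pi\big),$$ the sums running over 2-element subsets, elements and 3-element subsets of $\{1,\dots,n\}$. Let $|G_n\rangle=2^{-n/2}\sum_{x\in\{0,1\}^n}(-1)^{\#\{i<j:\,x_i=x_j=1\}}|x\rangle$. Then: 1. The maximum of $T_n$ over deterministic assignments of values $\pm1$ to the observables (each correlator being replaced by the product of the values) is $\eta_C=2n\alpha_n+2\binom n3$. Every quantum realization satisfies $T_n\le\eta_Q=2n\alpha_n+4\binom n3$, and $\eta_C<\eta_Q$.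 2. $|G_n\rangle$ is the complete-graph state: up to a phase it is the unique unit vector $\varphi\in(\mathbb C^2)^{\otimes n}$ with $X_i\prod_{k\ne i}Z_k\,\varphi=\varphi$ for all $i$. The state $|G_n\rangle$ with $A_i=X_i$, $B_j=Z_j$, $N_{ij}=X_i\otimes X_j\bigotimes_{k\ne i,j}Z_k$ is a quantum realization with $T_n=\eta_Q$. 3. Suppose that a quantum realization attains $T_n=\eta_Q$. Let $V_n$ be the span of the vectors $B_{i_1}\cdots B_{i_k}|\psi\rangle$ with $0\le k\le n$ and $i_1<\dots<i_k$, and let $P:\mathcal H\to V_n$ be the orthogonal projection, with adjoint $P^\dagger$ the inclusion. Then $|\psi\rangle\in V_n$, the subspace $V_n$ is invariant under all $A_i,B_j,N_{ij}$, $\dim V_n=2^n$ (so $\dim\mathcal H\ge2^n$), and there is a unitary $U:V_n\to(\mathbb C^2)^{\otimes n}=\mathbb C^{2^n}$ such that $$U(PA_iP^\dagger)U^\dagger=X_i,\quad U(PB_jP^\dagger)U^\dagger=Z_j,\quad U(PN_{ij}P^\dagger)U^\dagger=X_i\otimes X_j\bigotimes_{k\ne i,j}Z_k,\quad U(P|\psi\rangle)=|G_n\rangle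 .$$ -/

import Mathlib

noncomputable section

namespace TemporalSelfTest

/-! ### Sequential projective measurements of `±1`-valued observables -/

section Sequential

variable {H : Type*} [NormedAddCommGroup H] [InnerProductSpace ℂ H]

/-- For an observable `M` with `M² = 1`, the spectral projection `(1 + m M) / 2` of the
outcome `m = ±1`. -/
def outcomeProj (M : H →L[ℂ] H) (m : ℤˣ) : H →L[ℂ] H :=
  (1 / 2 : ℂ) • (1 + ((m : ℤ) : ℂ) • M)

/-- Born's rule with the projection postulate: the probability of the outcomes `m 0, m 1, …` when
the observables in the list `L` are measured one after the other, the head of `L` first, on the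
pure state `ψ`. -/
def jointProb (ψ : H) (L : List (H →L[ℂ] H)) (m : Fin L.length → ℤˣ) : ℝ :=
  ‖(List.ofFn fun t => outcomeProj (L.get t) (m t)).foldl (fun v Q => Q v) ψ‖ ^ 2

/-- The sequential correlation: the expected product of the outcomes. -/
def seqCorr (ψ : H) (L : List (H →L[ℂ] H)) : ℝ :=
  ∑ m : Fin L.length → ℤˣ, (∏ t, ((m t : ℤ) : ℝ)) * jointProb ψ L m

end Sequential

/-! ### Symmetrized sequential correlations -/

section Scheme

variable {α : Type*} [DecidableEq α]

/-- The words that occur when the nested anticommutator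
`{a₁, {a₂, …, {aₘ₋₁, aₘ}}}` of the letters of the list `[a₁, …, aₘ]` is multiplied out. -/
def expansion : List α → Finset (List α)
  | [] => {[]}
  | a :: l => (expansion l).image (fun w => a :: w) ∪ (expansion l).image (fun w => w ++ [a])

/-- `l` lists every element of `c` exactly once. -/
def IsOrdering (c : Finset α) (l : List α) : Prop :=
  l.Nodup ∧ l.toFinset = c

/-- A choice of sequential correlations for the measurements in `c`: a finite set of orders
in which they are measured, such that every permutation of them occurs in at least one of the
nested anticommutators that express these sequential correlations. -/
structure PermScheme (c : Finset α) where
  orders : Finset (List α)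
  isOrdering : ∀ l ∈ orders, IsOrdering c l
  covers : ∀ w, IsOrdering c w → ∃ l ∈ orders, w ∈ expansion l

theorem mem_expansion_self (l : List α) : l ∈ expansion l := by
  induction l with
  | nil => simp [expansion]
  | cons a l ih => simp [expansion, ih]

/-- Measuring in all possible orders is such a choice. -/
instance (c : Finset α) : Nonempty (PermScheme c) :=
  ⟨{ orders := c.toList.permutations.toFinset
     isOrdering := fun l hl => by
       have h : l.Perm c.toList := by simpa using hl
       exact ⟨h.nodup_iff.2 c.nodup_toList, by rw [List.toFinset_eq_of_perm _ _ h]; simp⟩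
     covers := fun w hw => ⟨w, by
       have : w.Perm c.toList := hw.2 ▸ (List.toFinset_toList hw.1).symm
       simpa using this, mem_expansion_self w⟩ }⟩

variable {H : Type*} [NormedAddCommGroup H] [InnerProductSpace ℂ H]

/-- The correlator `⟨⋯⟩_π`: the average of the sequential correlations chosen by the scheme. -/
def piCorr {c : Finset α} (S : PermScheme c) (ψ : H) (M : α → H →L[ℂ] H) : ℝ :=
  (∑ l ∈ S.orders, seqCorr ψ (l.map M)) / (S.orders.card : ℝ)

end Scheme

/-! ### The `n`-qubit expression -/

/-- Unordered pairs `{i, j}` with `i ≠ j`. -/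
abbrev Edge (n : ℕ) : Type := {e : Sym2 (Fin n) // ¬ e.IsDiag}

/-- The names of the observables `A_i`, `B_i` and `N_ij = N_ji`. -/
inductive Obs (n : ℕ) : Type
  | A (i : Fin n) : Obs n
  | B (i : Fin n) : Obs n
  | N (e : Edge n) : Obs n
  deriving DecidableEq

/-- The observables `A_i` for `i ∈ s` together with the `B_k` for `k ∉ s`. -/
def ctxAB {n : ℕ} (s : Finset (Fin n)) : Finset (Obs n) :=
  Finset.univ.image fun k => if k ∈ s then Obs.A k else Obs.B k

/-- The observables `A_i`, `A_j`, `N_ij` together with the `B_k` for `k ≠ i, j`,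
where `e = {i, j}`. -/
def ctxABN {n : ℕ} (e : Edge n) : Finset (Obs n) :=
  insert (Obs.N e) (ctxAB (Finset.univ.filter fun k => k ∈ e.1))

/-- For `t = {i, j, k}` and `j ∈ t`: the two observables `N_ij` and `N_jk`. -/
def ctxNN {n : ℕ} (t : Finset (Fin n)) (j : Fin n) : Finset (Obs n) :=
  (Finset.univ.filter fun e : Edge n => j ∈ e.1 ∧ ∀ k ∈ e.1, k ∈ t).image Obs.N

/-- `α_n`. -/
def alpha (n : ℕ) : ℝ := ((n - 1).choose 2 : ℝ)

/-- The linear expression, as a function of the values of its correlators. -/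
def expr (n : ℕ) (corr : Finset (Obs n) → ℝ) : ℝ :=
  ((n : ℝ) - 2) * ∑ e : Edge n, corr (ctxABN e)
    + alpha n * ∑ i : Fin n, corr (ctxAB {i})
    - ∑ t ∈ Finset.powersetCard 3 (Finset.univ : Finset (Fin n)), corr (ctxAB t)
    + ∑ t ∈ Finset.powersetCard 3 (Finset.univ : Finset (Fin n)), ∑ j ∈ t, corr (ctxNN t j)

/-- The classical bound. -/
def etaC (n : ℕ) : ℝ := 2 * alpha n * n + 2 * (n.choose 3 : ℝ)

/-- The quantum bound. -/
def etaQ (n : ℕ) : ℝ := 2 * alpha n * n + 4 * (n.choose 3 : ℝ)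

/-- The value of the expression in the deterministic assignment `m` of outcomes. -/
def classicalValue (n : ℕ) (m : Obs n → ℤˣ) : ℝ :=
  expr n fun c => ∏ a ∈ c, ((m a : ℤ) : ℝ)

/-- The quantum value `T_n` for the state `ψ` and the observables `M`. -/
def temporalValue {n : ℕ} (π : ∀ c : Finset (Obs n), PermScheme c)
    {H : Type*} [NormedAddCommGroup H] [InnerProductSpace ℂ H]
    (ψ : H) (M : Obs n → H →L[ℂ] H) : ℝ :=
  expr n fun c => piCorr (π c) ψ M

/-- A pure state and dichotomic observables; no compatibility is required. -/
structure IsRealization {n : ℕ} {H : Type*} [NormedAddCommGroup H] [InnerProductSpace ℂ H]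
    [CompleteSpace H] (ψ : H) (M : Obs n → H →L[ℂ] H) : Prop where
  norm_state : ‖ψ‖ = 1
  selfAdjoint : ∀ a, IsSelfAdjoint (M a)
  sq_eq_one : ∀ a, M a * M a = 1

/-! ### The reference experiment on `n` qubits -/

/-- `(ℂ²)^{⊗ n}`, with the computational basis labelled by bit strings. -/
abbrev Qubits (n : ℕ) : Type := EuclideanSpace ℂ (Fin n → Fin 2)

def pauliX : Matrix (Fin 2) (Fin 2) ℂ := !![0, 1; 1, 0]

def pauliZ : Matrix (Fin 2) (Fin 2) ℂ := !![1, 0; 0, -1]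

/-- The operator `K₁ ⊗ ⋯ ⊗ Kₙ`. -/
def tensorOp {n : ℕ} (K : Fin n → Matrix (Fin 2) (Fin 2) ℂ) : Qubits n →L[ℂ] Qubits n :=
  Matrix.toEuclideanCLM (n := Fin n → Fin 2) (𝕜 := ℂ)
    (Matrix.of fun x y => ∏ k, K k (x k) (y k))

/-- `A_i = X_i`, `B_i = Z_i`, `N_ij = X_i X_j ⨂_{k ≠ i,j} Z_k`. -/
def pauliObs {n : ℕ} : Obs n → Qubits n →L[ℂ] Qubits n
  | .A i => tensorOp fun k => if k = i then pauliX else 1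
  | .B i => tensorOp fun k => if k = i then pauliZ else 1
  | .N e => tensorOp fun k => if k ∈ e.1 then pauliX else pauliZ

/-- A unit vector stabilized by `X_i ⨂_{k ∈ N(i)} Z_k` for every vertex `i` of the graph `Γ`. -/
def IsGraphState {n : ℕ} (Γ : SimpleGraph (Fin n)) (φ : Qubits n) : Prop :=
  open scoped Classical in
  ‖φ‖ = 1 ∧ ∀ i, tensorOp (fun k => if k = i then pauliX else if Γ.Adj i k then pauliZ else 1) φ = φ

/-- The complete-graph state `2^{-n/2} ∑_x (-1)^{#{i < j : x_i = x_j = 1}} |x⟩`. -/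
def completeGraphState (n : ℕ) : Qubits n :=
  WithLp.toLp 2 fun x =>
    ((Real.sqrt 2 : ℂ)⁻¹) ^ n *
      ∏ i : Fin n, ∏ j ∈ Finset.Ioi i, if x i = 1 ∧ x j = 1 then (-1 : ℂ) else 1

/-! ### The invariant subspace -/

section Subspace

variable {n : ℕ} {H : Type*} [NormedAddCommGroup H] [InnerProductSpace ℂ H]

/-- `B_{i₁} ⋯ B_{iₖ} ψ` for `s = {i₁ < ⋯ < iₖ}`. -/
def wordB (ψ : H) (M : Obs n → H →L[ℂ] H) (s : Finset (Fin n)) : H :=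
  (((List.finRange n).filter (· ∈ s)).map fun i => M (.B i)).prod ψ

/-- The subspace `V_n` spanned by these vectors. -/
def invSubspace (ψ : H) (M : Obs n → H →L[ℂ] H) : Submodule ℂ H :=
  Submodule.span ℂ (Set.range (wordB ψ M))

instance (ψ : H) (M : Obs n → H →L[ℂ] H) : FiniteDimensional ℂ (invSubspace ψ M) :=
  FiniteDimensional.span_of_finite ℂ (Set.finite_range _)

end Subspace

end TemporalSelfTest

end

open TemporalSelfTest

/-!
Each edge `{i, j}` lies in `n - 2` triples and each vertex in `α_n` triples, so `T_n` is a sum over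
the 3-element subsets of ten signed correlators each, and `η_Q = 10 * C(n, 3)`. Classically the
correlator of a triple is the product of the correlators of its vertices, which enter with the
opposite sign, so that a triple contributes at most 8.

A sequential correlator is the expectation of a normalized nested anticommutator of self-adjoint
involutions, and it equals `±1` only if each product in the expansion of that anticommutator maps
`ψ` to `±ψ`. Hence at `T_n = η_Q` every ordering of every context acts on `ψ` by a sign. Cancelling
common factors between contexts shows that each observable permutes the vectors `B_{i₁} ⋯ B_{iₖ} ψ`
up to signs that do not depend on the realization, and these vectors are orthonormal because the
operators `A_i ∏_{k ≠ i} B_k` separate them by their eigenvalues `±1`. So any two maximal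
realizations are unitarily equivalent on the spans `V_n`, and it remains to see that the Pauli
realization is maximal.
-/

noncomputable section

namespace TemporalSelfTest

/-! ### Sequential correlations and nested anticommutators -/

section Average

variable {ι : Type*} {s : Finset ι} {f : ι → ℝ}

theorem sum_le_card (hf : ∀ i ∈ s, f i ≤ 1) : ∑ i ∈ s, f i ≤ s.card := by
  simpa using Finset.sum_le_sum hf

theorem sum_eq_card_iff (hf : ∀ i ∈ s, f i ≤ 1) :
    ∑ i ∈ s, f i = s.card ↔ ∀ i ∈ s, f i = 1 := by
  simpa using Finset.sum_eq_sum_iff_of_le (g := fun _ => (1 : ℝ)) hf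

theorem average_eq_unit_iff (hs : s.Nonempty) (hf : ∀ i ∈ s, |f i| ≤ 1) (ε : ℤˣ) :
    (∑ i ∈ s, f i) / s.card = ((ε : ℤ) : ℝ) ↔ ∀ i ∈ s, f i = ((ε : ℤ) : ℝ) := by
  have hcard : (s.card : ℝ) ≠ 0 := by exact_mod_cast hs.card_ne_zero
  rw [div_eq_iff hcard]
  rcases Int.units_eq_one_or ε with rfl | rfl
  · simpa using sum_eq_card_iff fun i hi => (abs_le.1 (hf i hi)).2
  · have := sum_eq_card_iff fun i hi => neg_le.1 (abs_le.1 (hf i hi)).1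
    simpa [neg_eq_iff_eq_neg] using this

theorem abs_average_le_one (hs : s.Nonempty) (hf : ∀ i ∈ s, |f i| ≤ 1) :
    |(∑ i ∈ s, f i) / s.card| ≤ 1 := by
  have hcard : (0 : ℝ) < s.card := by exact_mod_cast hs.card_pos
  rw [abs_div, Nat.abs_cast, div_le_one hcard]
  exact (Finset.abs_sum_le_sum_abs f s).trans (sum_le_card hf)

end Average

section Sequential

variable {H : Type*} [NormedAddCommGroup H] [InnerProductSpace ℂ H]

/-- The nested anticommutator `{M₁, {M₂, …, {Mᵣ₋₁, Mᵣ}}}`, normalized by a factor `1 / 2` for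
each anticommutator. The recursion ends with `{Mᵣ, 1} / 2 = Mᵣ`. -/
def nestedAnticomm : List (H →L[ℂ] H) → H →L[ℂ] H
  | [] => 1
  | M :: L => (1 / 2 : ℂ) • (M * nestedAnticomm L + nestedAnticomm L * M)

theorem seqCorr_nil (ψ : H) : seqCorr ψ [] = ‖ψ‖ ^ 2 := by
  simp [seqCorr, jointProb]

theorem seqCorr_cons (ψ : H) (M : H →L[ℂ] H) (L : List (H →L[ℂ] H)) :
    seqCorr ψ (M :: L) = ∑ m : ℤˣ, ((m : ℤ) : ℝ) * seqCorr (outcomeProj M m ψ) L := by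
  simp only [seqCorr, Finset.mul_sum]
  rw [← Fintype.sum_prod_type']
  refine (Fintype.sum_equiv (Fin.consEquiv fun _ : Fin (L.length + 1) => ℤˣ) _ _ ?_).symm
  rintro ⟨m, f⟩
  rw [← mul_assoc]
  congr 1
  · exact (Fin.prod_univ_succ fun t => (((Fin.cons m f : Fin (L.length + 1) → ℤˣ) t : ℤ) : ℝ)).symm
  · simp only [jointProb, List.length_cons, Fin.consEquiv_apply, List.ofFn_succ, Fin.cons_zero,
      Fin.cons_succ, List.foldl_cons]
    rfl

theorem sum_re_inner_outcomeProj (T X : H →L[ℂ] H) (ψ : H) :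
    ∑ m : ℤˣ, ((m : ℤ) : ℝ) * (inner ℂ (outcomeProj T m ψ) (X (outcomeProj T m ψ))).re =
      ((inner ℂ (T ψ) (X ψ)).re + (inner ℂ ψ (X (T ψ))).re) / 2 := by
  have hplus : outcomeProj T 1 ψ = (1 / 2 : ℂ) • (ψ + T ψ) := by simp [outcomeProj]
  have hminus : outcomeProj T (-1) ψ = (1 / 2 : ℂ) • (ψ - T ψ) := by
    simp [outcomeProj, sub_eq_add_neg]
  have hhalf (v : H) : (inner ℂ ((1 / 2 : ℂ) • v) (X ((1 / 2 : ℂ) • v))).re =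
      (inner ℂ v (X v)).re / 4 := by
    rw [map_smul, inner_smul_left, inner_smul_right, ← mul_assoc,
      ← Complex.normSq_eq_conj_mul_self, Complex.re_ofReal_mul,
      show Complex.normSq (1 / 2) = 1 / 4 by norm_num]
    ring
  have sum_units (f : ℤˣ → ℝ) : ∑ m, f m = f 1 + f (-1) := Finset.sum_pair (by decide)
  rw [sum_units, hplus, hminus, hhalf, hhalf]
  simp only [Units.val_one, Units.val_neg, Int.cast_neg, Int.cast_one, map_add, map_sub,
    inner_add_left, inner_add_right, inner_sub_left, inner_sub_right, Complex.add_re,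
    Complex.sub_re]
  ring

theorem re_inner_eq_one_iff {φ ψ : H} (hφ : ‖φ‖ = 1) (hψ : ‖ψ‖ = 1) :
    (inner ℂ φ ψ).re = 1 ↔ ψ = φ := by
  have hsq := @norm_sub_sq ℂ _ _ _ _ φ ψ
  rw [hφ, hψ, RCLike.re_eq_complex_re] at hsq
  rw [eq_comm (a := ψ), ← sub_eq_zero (a := φ), ← norm_eq_zero, ← sq_eq_zero_iff, hsq]
  constructor <;> intro h <;> linarith

variable [CompleteSpace H]

/-- The observables with outcomes `±1`: self-adjoint involutions. -/
structure IsDichotomic (T : H →L[ℂ] H) : Prop where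
  selfAdjoint : IsSelfAdjoint T
  sq_eq_one : T * T = 1

namespace IsDichotomic

variable {T : H →L[ℂ] H}

theorem apply_apply (hT : IsDichotomic T) (v : H) : T (T v) = v := by
  rw [← mul_apply_eq_comp, hT.sq_eq_one, one_apply_eq_self]

theorem apply_eq_iff (hT : IsDichotomic T) {v w : H} : T v = w ↔ v = T w := by
  constructor <;> rintro rfl <;> rw [hT.apply_apply]

theorem norm_apply (hT : IsDichotomic T) (v : H) : ‖T v‖ = ‖v‖ := by
  rw [← sq_eq_sq₀ (norm_nonneg _) (norm_nonneg _), ← @inner_self_eq_norm_sq ℂ,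
    ← @inner_self_eq_norm_sq ℂ, hT.selfAdjoint.isSymmetric.apply_clm, hT.apply_apply]

end IsDichotomic

theorem IsRealization.isDichotomic {n : ℕ} {ψ : H} {M : Obs n → H →L[ℂ] H}
    (h : IsRealization ψ M) (a : Obs n) : IsDichotomic (M a) :=
  ⟨h.selfAdjoint a, h.sq_eq_one a⟩

theorem re_inner_nestedAnticomm_cons {T : H →L[ℂ] H} (hT : IsSelfAdjoint T)
    (L : List (H →L[ℂ] H)) (φ ψ : H) :
    (inner ℂ φ (nestedAnticomm (T :: L) ψ)).re =
      ((inner ℂ (T φ) (nestedAnticomm L ψ)).re + (inner ℂ φ (nestedAnticomm L (T ψ))).re) / 2 := by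
  simp only [nestedAnticomm, smul_apply, add_apply, mul_apply_eq_comp, inner_smul_right,
    inner_add_right, ← hT.isSymmetric.apply_clm φ, one_div, Complex.mul_re, Complex.inv_re,
    Complex.inv_im, Complex.re_ofNat, Complex.im_ofNat, Complex.normSq_ofNat, Complex.add_re]
  ring

theorem seqCorr_eq_re_inner {L : List (H →L[ℂ] H)} (hL : ∀ T ∈ L, IsSelfAdjoint T) (ψ : H) :
    seqCorr ψ L = (inner ℂ ψ (nestedAnticomm L ψ)).re := by
  induction L generalizing ψ with
  | nil => simp [seqCorr_nil, nestedAnticomm, inner_self_eq_norm_sq_to_K, ← Complex.ofReal_pow]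
  | cons T L ih =>
    obtain ⟨hT, hL⟩ := List.forall_mem_cons.1 hL
    simp only [seqCorr_cons, ih hL, sum_re_inner_outcomeProj, re_inner_nestedAnticomm_cons hT]

theorem norm_nestedAnticomm_apply_le {L : List (H →L[ℂ] H)} (hL : ∀ T ∈ L, IsDichotomic T)
    (v : H) : ‖nestedAnticomm L v‖ ≤ ‖v‖ := by
  induction L generalizing v with
  | nil => simp [nestedAnticomm]
  | cons T L ih =>
    obtain ⟨hT, hL⟩ := List.forall_mem_cons.1 hL
    calc ‖nestedAnticomm (T :: L) v‖
        = 1 / 2 * ‖T (nestedAnticomm L v) + nestedAnticomm L (T v)‖ := by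
          rw [nestedAnticomm, smul_apply, norm_smul]
          simp
      _ ≤ 1 / 2 * (‖T (nestedAnticomm L v)‖ + ‖nestedAnticomm L (T v)‖) := by
          gcongr
          exact norm_add_le _ _
      _ ≤ 1 / 2 * (‖v‖ + ‖T v‖) := by
          gcongr
          · exact (hT.norm_apply _).trans_le (ih hL v)
          · exact ih hL (T v)
      _ = ‖v‖ := by rw [hT.norm_apply]; ring

theorem abs_re_inner_nestedAnticomm_le {L : List (H →L[ℂ] H)} (hL : ∀ T ∈ L, IsDichotomic T)
    {φ ψ : H} (hφ : ‖φ‖ = 1) (hψ : ‖ψ‖ = 1) : |(inner ℂ φ (nestedAnticomm L ψ)).re| ≤ 1 :=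
  calc |(inner ℂ φ (nestedAnticomm L ψ)).re|
      ≤ ‖inner ℂ φ (nestedAnticomm L ψ)‖ := Complex.abs_re_le_norm _
    _ ≤ ‖φ‖ * ‖nestedAnticomm L ψ‖ := norm_inner_le_norm _ _
    _ ≤ 1 := by rw [hφ, one_mul, ← hψ]; exact norm_nestedAnticomm_apply_le hL ψ

theorem abs_seqCorr_le_one {L : List (H →L[ℂ] H)} (hL : ∀ T ∈ L, IsDichotomic T) {ψ : H}
    (hψ : ‖ψ‖ = 1) : |seqCorr ψ L| ≤ 1 := by
  rw [seqCorr_eq_re_inner fun T hT => (hL T hT).selfAdjoint]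
  exact abs_re_inner_nestedAnticomm_le hL hψ hψ

end Sequential

/-! ### Extremal values of the symmetrized correlators -/

section Words

variable {α : Type*} [DecidableEq α] {c : Finset α} {l w : List α}

theorem isOrdering_iff_perm : IsOrdering c l ↔ l.Perm c.toList :=
  ⟨fun h => h.2 ▸ (List.toFinset_toList h.1).symm, fun h =>
    ⟨h.nodup_iff.2 c.nodup_toList, by rw [List.toFinset_eq_of_perm _ _ h, Finset.toList_toFinset]⟩⟩

theorem IsOrdering.of_perm (hl : IsOrdering c l) (h : w.Perm l) : IsOrdering c w :=
  isOrdering_iff_perm.2 (h.trans (isOrdering_iff_perm.1 hl))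

theorem forall_mem_expansion_cons {a : α} {p : List α → Prop} :
    (∀ w ∈ expansion (a :: l), p w) ↔
      (∀ w ∈ expansion l, p (a :: w)) ∧ ∀ w ∈ expansion l, p (w ++ [a]) := by
  simp only [expansion, Finset.mem_union, or_imp, forall_and, Finset.forall_mem_image]

theorem perm_of_mem_expansion : ∀ w ∈ expansion l, w.Perm l := by
  induction l with
  | nil => simp [expansion]
  | cons a l ih =>
    exact forall_mem_expansion_cons.2 ⟨fun w hw => (ih w hw).cons a, fun w hw =>
      (List.perm_append_singleton a w).trans ((ih w hw).cons a)⟩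

theorem PermScheme.orders_nonempty (S : PermScheme c) : S.orders.Nonempty := by
  obtain ⟨l, hl, -⟩ := S.covers c.toList (isOrdering_iff_perm.2 (.refl _))
  exact ⟨l, hl⟩

variable {H : Type*} [NormedAddCommGroup H] [InnerProductSpace ℂ H] [CompleteSpace H]
  {M : α → H →L[ℂ] H} {φ ψ : H}

theorem re_inner_nestedAnticomm_eq_one_iff (hM : ∀ a, IsDichotomic (M a)) (hφ : ‖φ‖ = 1)
    (hψ : ‖ψ‖ = 1) :
    (inner ℂ φ (nestedAnticomm (l.map M) ψ)).re = 1 ↔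
      ∀ w ∈ expansion l, (w.map M).prod ψ = φ := by
  induction l generalizing φ ψ with
  | nil => simpa [nestedAnticomm, expansion] using re_inner_eq_one_iff hφ hψ
  | cons a l ih =>
    have hφ' : ‖M a φ‖ = 1 := ((hM a).norm_apply φ).trans hφ
    have hψ' : ‖M a ψ‖ = 1 := ((hM a).norm_apply ψ).trans hψ
    have hl : ∀ T ∈ l.map M, IsDichotomic T := List.forall_mem_map.2 fun b _ => hM b
    have hleft := (abs_le.1 (abs_re_inner_nestedAnticomm_le hl hφ' hψ)).2
    have hright := (abs_le.1 (abs_re_inner_nestedAnticomm_le hl hφ hψ')).2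
    simp only [forall_mem_expansion_cons, List.map_cons, List.map_append, List.map_nil,
      List.prod_cons, List.prod_append, List.prod_nil, mul_one, mul_apply_eq_comp,
      (hM a).apply_eq_iff]
    rw [← ih hφ' hψ, ← ih hφ hψ', re_inner_nestedAnticomm_cons (hM a).selfAdjoint]
    constructor
    · intro h
      constructor <;> linarith
    · rintro ⟨h₁, h₂⟩
      linarith

theorem seqCorr_map_eq_unit_iff (hM : ∀ a, IsDichotomic (M a)) (hψ : ‖ψ‖ = 1) (ε : ℤˣ) :
    seqCorr ψ (l.map M) = ((ε : ℤ) : ℝ) ↔ ∀ w ∈ expansion l, (w.map M).prod ψ = ε • ψ := by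
  have hεψ : ‖ε • ψ‖ = 1 := by rcases Int.units_eq_one_or ε with rfl | rfl <;> simpa
  rw [← re_inner_nestedAnticomm_eq_one_iff hM hεψ hψ,
    seqCorr_eq_re_inner (List.forall_mem_map.2 fun a _ => (hM a).selfAdjoint)]
  rcases Int.units_eq_one_or ε with rfl | rfl <;> simp [inner_neg_left, neg_eq_iff_eq_neg]

/-- Every word that lists the letters of `c` once each multiplies the state by the sign `ε`. -/
def WordsAct (ψ : H) (M : α → H →L[ℂ] H) (c : Finset α) (ε : ℤˣ) : Prop :=
  ∀ w, IsOrdering c w → (w.map M).prod ψ = ε • ψ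

theorem abs_piCorr_le_one (hM : ∀ a, IsDichotomic (M a)) (hψ : ‖ψ‖ = 1) (S : PermScheme c) :
    |piCorr S ψ M| ≤ 1 :=
  abs_average_le_one S.orders_nonempty fun _ _ =>
    abs_seqCorr_le_one (List.forall_mem_map.2 fun a _ => hM a) hψ

theorem piCorr_eq_unit_iff (hM : ∀ a, IsDichotomic (M a)) (hψ : ‖ψ‖ = 1) (S : PermScheme c)
    (ε : ℤˣ) : piCorr S ψ M = ((ε : ℤ) : ℝ) ↔ WordsAct ψ M c ε := by
  rw [piCorr, average_eq_unit_iff S.orders_nonempty fun _ _ =>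
    abs_seqCorr_le_one (List.forall_mem_map.2 fun a _ => hM a) hψ]
  simp only [seqCorr_map_eq_unit_iff hM hψ]
  constructor
  · intro h w hw
    obtain ⟨l, hl, hwl⟩ := S.covers w hw
    exact h l hl w hwl
  · intro h l hl w hw
    exact h w ((S.isOrdering l hl).of_perm (perm_of_mem_expansion w hw))

end Words

/-! ### Decomposition into triples -/

section Counting

theorem sum_powersetCard_sum_subset {V ι : Type*} [Fintype V] [DecidableEq V] [Fintype ι]
    {support : ι → Finset V} {d r : ℕ} (hd : ∀ x, (support x).card = d) (hdr : d ≤ r)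
    (f : ι → ℝ) :
    ∑ t ∈ Finset.powersetCard r Finset.univ, ∑ x with support x ⊆ t, f x =
      (Fintype.card V - d).choose (r - d) * ∑ x, f x := by
  rw [Finset.sum_comm' (t' := Finset.univ)
    (s' := fun x => {t ∈ Finset.powersetCard r Finset.univ | support x ⊆ t}) (by simp),
    Finset.mul_sum]
  refine Finset.sum_congr rfl fun x _ => ?_
  rw [Finset.sum_const, Finset.card_filter_powersetCard_subset _ _ _ (Finset.subset_univ _)
    ((hd x).trans_le hdr), hd, Finset.card_univ, nsmul_eq_mul]

theorem alpha_mul_eq_three_mul_choose (n : ℕ) : alpha n * n = 3 * n.choose 3 := by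
  rcases n with _ | n
  · simp
  · have := Nat.add_one_mul_choose_eq n 2
    rw [alpha, Nat.add_sub_cancel]
    norm_cast
    linarith

theorem etaC_eq_sum (n : ℕ) :
    etaC n = ∑ _t ∈ Finset.powersetCard 3 (Finset.univ : Finset (Fin n)), 8 := by
  rw [etaC, mul_assoc, alpha_mul_eq_three_mul_choose]
  simp only [Finset.sum_const, Finset.card_powersetCard, Finset.card_univ, Fintype.card_fin,
    nsmul_eq_mul]
  ring

theorem etaQ_eq_sum (n : ℕ) :
    etaQ n = ∑ _t ∈ Finset.powersetCard 3 (Finset.univ : Finset (Fin n)), 10 := by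
  rw [etaQ, mul_assoc, alpha_mul_eq_three_mul_choose]
  simp only [Finset.sum_const, Finset.card_powersetCard, Finset.card_univ, Fintype.card_fin,
    nsmul_eq_mul]
  ring

theorem etaC_lt_etaQ {n : ℕ} (hn : 3 ≤ n) : etaC n < etaQ n := by
  have : (0 : ℝ) < n.choose 3 := by exact_mod_cast Nat.choose_pos hn
  rw [etaC, etaQ]
  linarith

end Counting

section Triples

variable {n : ℕ} {corr : Finset (Obs n) → ℝ} {t : Finset (Fin n)}

/-- The edges whose endpoints lie in `t`. -/
def edgesIn (t : Finset (Fin n)) : Finset (Edge n) :=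
  {e | e.1.toFinset ⊆ t}

theorem mem_edgesIn {e : Edge n} : e ∈ edgesIn t ↔ e.1.toFinset ⊆ t := by
  simp [edgesIn]

theorem card_edgesIn (t : Finset (Fin n)) : (edgesIn t).card = t.card.choose 2 := by
  rw [← Sym2.card_image_offDiag, ← Finset.card_map (Function.Embedding.subtype _)]
  congr 1
  ext e
  induction e using Sym2.ind with
  | _ i j =>
    simp only [edgesIn, Finset.subset_iff, Sym2.mem_toFinset, Finset.mem_map, Finset.mem_filter,
      Finset.mem_univ, true_and, Function.Embedding.subtype_apply, Subtype.exists, exists_and_left,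
      exists_prop, exists_eq_right_right, Sym2.mem_iff, forall_eq_or_imp, forall_eq,
      Sym2.mk_isDiag_iff, Finset.mem_image, Finset.mem_offDiag, Prod.exists,
      Function.uncurry_apply_pair, Sym2.eq_iff]
    grind

/-- The contribution of the triple `t` to the expression, where `(n - 2) ∑_e ⟨⋯⟩` is distributed
over the `n - 2` triples containing each edge and `α_n ∑_i ⟨⋯⟩` over the `α_n` triples containing
each vertex. -/
def tripleExpr (corr : Finset (Obs n) → ℝ) (t : Finset (Fin n)) : ℝ :=
  ∑ e ∈ edgesIn t, corr (ctxABN e) + ∑ i ∈ t, corr (ctxAB {i}) - corr (ctxAB t) +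
    ∑ j ∈ t, corr (ctxNN t j)

theorem expr_eq_sum_tripleExpr (hn : 2 ≤ n) (corr : Finset (Obs n) → ℝ) :
    expr n corr = ∑ t ∈ Finset.powersetCard 3 Finset.univ, tripleExpr corr t := by
  have hedges := sum_powersetCard_sum_subset (r := 3)
    (fun e : Edge n => Sym2.card_toFinset_of_not_isDiag e.1 e.2) (by norm_num)
    fun e => corr (ctxABN e)
  have hvertices := sum_powersetCard_sum_subset (V := Fin n) (r := 3) Finset.card_singleton
    (by norm_num) fun i => corr (ctxAB {i})
  simp only [Fintype.card_fin, Nat.reduceSub, Nat.choose_one_right, Nat.cast_sub hn,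
    Nat.cast_ofNat] at hedges
  simp only [Fintype.card_fin, Finset.singleton_subset_iff, Finset.filter_mem_eq_inter,
    Finset.univ_inter, Nat.reduceSub] at hvertices
  simp only [tripleExpr, edgesIn, Finset.sum_add_distrib, Finset.sum_sub_distrib]
  rw [hedges, hvertices, expr, alpha]

theorem tripleExpr_le_ten (ht : t.card = 3) (hcorr : ∀ c, |corr c| ≤ 1) :
    tripleExpr corr t ≤ 10 := by
  have hle c : corr c ≤ 1 := (abs_le.1 (hcorr c)).2
  have hge : -1 ≤ corr (ctxAB t) := (abs_le.1 (hcorr _)).1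
  have hedges := sum_le_card fun e (_ : e ∈ edgesIn t) => hle (ctxABN e)
  have hvertices := sum_le_card fun i (_ : i ∈ t) => hle (ctxAB {i})
  have hpairs := sum_le_card fun j (_ : j ∈ t) => hle (ctxNN t j)
  rw [card_edgesIn, ht] at hedges
  rw [ht] at hvertices hpairs
  norm_num at hedges hvertices hpairs
  rw [tripleExpr]
  linarith

theorem tripleExpr_eq_ten_iff (ht : t.card = 3) (hcorr : ∀ c, |corr c| ≤ 1) :
    tripleExpr corr t = 10 ↔
      (∀ e ∈ edgesIn t, corr (ctxABN e) = 1) ∧ (∀ i ∈ t, corr (ctxAB {i}) = 1) ∧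
        corr (ctxAB t) = -1 ∧ ∀ j ∈ t, corr (ctxNN t j) = 1 := by
  have hle c : corr c ≤ 1 := (abs_le.1 (hcorr c)).2
  have hge : -1 ≤ corr (ctxAB t) := (abs_le.1 (hcorr _)).1
  have hedges := sum_le_card fun e (_ : e ∈ edgesIn t) => hle (ctxABN e)
  have hvertices := sum_le_card fun i (_ : i ∈ t) => hle (ctxAB {i})
  have hpairs := sum_le_card fun j (_ : j ∈ t) => hle (ctxNN t j)
  rw [← sum_eq_card_iff fun _ _ => hle _, ← sum_eq_card_iff fun _ _ => hle _,
    ← sum_eq_card_iff fun _ _ => hle _, tripleExpr]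
  rw [card_edgesIn, ht] at hedges ⊢
  rw [ht] at hvertices hpairs
  norm_num at hedges hvertices hpairs ⊢
  constructor
  · intro h
    refine ⟨?_, ?_, ?_, ?_⟩ <;> linarith
  · rintro ⟨h₁, h₂, h₃, h₄⟩
    linarith

theorem expr_le_etaQ (hn : 2 ≤ n) (hcorr : ∀ c, |corr c| ≤ 1) : expr n corr ≤ etaQ n := by
  rw [expr_eq_sum_tripleExpr hn, etaQ_eq_sum]
  exact Finset.sum_le_sum fun t ht => tripleExpr_le_ten (Finset.mem_powersetCard.1 ht).2 hcorr

theorem exists_triple_superset (hn : 3 ≤ n) {s : Finset (Fin n)} (hs : s.card ≤ 3) :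
    ∃ t : Finset (Fin n), t.card = 3 ∧ s ⊆ t := by
  obtain ⟨t, hst, -, ht⟩ := Finset.exists_subsuperset_card_eq (Finset.subset_univ s) hs
    (by simpa using hn)
  exact ⟨t, ht, hst⟩

theorem expr_eq_etaQ_iff (hn : 3 ≤ n) (hcorr : ∀ c, |corr c| ≤ 1) :
    expr n corr = etaQ n ↔
      (∀ e, corr (ctxABN e) = 1) ∧ (∀ i, corr (ctxAB {i}) = 1) ∧
        ∀ t : Finset (Fin n), t.card = 3 →
          corr (ctxAB t) = -1 ∧ ∀ j ∈ t, corr (ctxNN t j) = 1 := by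
  have hmax : expr n corr = etaQ n ↔
      ∀ t : Finset (Fin n), t.card = 3 → tripleExpr corr t = 10 := by
    rw [expr_eq_sum_tripleExpr (by omega), etaQ_eq_sum, Finset.sum_eq_sum_iff_of_le fun t ht =>
      tripleExpr_le_ten (Finset.mem_powersetCard.1 ht).2 hcorr]
    simp [Finset.mem_powersetCard]
  rw [hmax]
  constructor
  · intro h
    refine ⟨fun e => ?_, fun i => ?_, fun t ht => ((tripleExpr_eq_ten_iff ht hcorr).1 (h t ht)).2.2⟩
    · obtain ⟨t, ht, het⟩ := exists_triple_superset hn (s := e.1.toFinset)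
        (by rw [Sym2.card_toFinset_of_not_isDiag e.1 e.2]; norm_num)
      exact ((tripleExpr_eq_ten_iff ht hcorr).1 (h t ht)).1 e (mem_edgesIn.2 het)
    · obtain ⟨t, ht, hit⟩ := exists_triple_superset hn (s := {i}) (by simp)
      exact ((tripleExpr_eq_ten_iff ht hcorr).1 (h t ht)).2.1 i (Finset.singleton_subset_iff.1 hit)
  · rintro ⟨hABN, hAB, htriple⟩ t ht
    exact (tripleExpr_eq_ten_iff ht hcorr).2 ⟨fun e _ => hABN e, fun i _ => hAB i, htriple t ht⟩

end Triples

/-! ### The classical bound -/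

section Classical

variable {n : ℕ}

/-- The observable measured at `k` in the context `ctxAB s`. -/
def localObs (s : Finset (Fin n)) (k : Fin n) : Obs n :=
  if k ∈ s then .A k else .B k

theorem injective_localObs (s : Finset (Fin n)) : Function.Injective (localObs s) := by
  intro k l h
  unfold localObs at h
  split_ifs at h <;> simpa using h

theorem prod_ctxAB {R : Type*} [CommMonoid R] (s : Finset (Fin n)) (f : Obs n → R) :
    ∏ a ∈ ctxAB s, f a = ∏ k, f (localObs s k) :=
  Finset.prod_image (injective_localObs s).injOn

theorem prod_ite_eq_of_odd_card {ι : Type*} [DecidableEq ι] {t : Finset ι} (ht : Odd t.card)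
    (k : ι) (a b : ℤˣ) :
    ∏ i ∈ t, (if k = i then a else b) = if k ∈ t then a else b := by
  have hb : b * b = 1 := Int.units_mul_self b
  have hsplit : ∀ i ∈ t, (if k = i then a else b) = b * if k = i then b * a else 1 := by
    intro i _
    split_ifs <;> simp [← mul_assoc, hb]
  rw [Finset.prod_congr rfl hsplit, Finset.prod_mul_distrib, Finset.prod_const,
    Finset.prod_ite_eq, Int.units_pow_eq_pow_mod_two, Nat.odd_iff.1 ht, pow_one]
  split_ifs <;> simp [← mul_assoc, hb]

theorem prod_ctxAB_eq_prod_prod (m : Obs n → ℤˣ) {t : Finset (Fin n)} (ht : Odd t.card) :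
    ∏ a ∈ ctxAB t, m a = ∏ i ∈ t, ∏ a ∈ ctxAB {i}, m a := by
  simp only [prod_ctxAB]
  rw [Finset.prod_comm]
  refine Finset.prod_congr rfl fun k _ => ?_
  simp only [localObs, Finset.mem_singleton, apply_ite m]
  exact (prod_ite_eq_of_odd_card ht k _ _).symm

theorem sum_sub_prod_le_two {ι : Type*} (u : ι → ℤˣ) {t : Finset ι}
    (ht : t.card = 3) :
    ∑ i ∈ t, ((u i : ℤ) : ℝ) - ((∏ i ∈ t, u i : ℤˣ) : ℤ) ≤ 2 := by
  classical
  obtain ⟨i, j, k, hij, hik, hjk, rfl⟩ := Finset.card_eq_three.1 ht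
  rw [Finset.sum_insert (by simp [hij, hik]), Finset.sum_pair hjk,
    Finset.prod_insert (by simp [hij, hik]), Finset.prod_pair hjk]
  rcases Int.units_eq_one_or (u i) with hi | hi <;>
    rcases Int.units_eq_one_or (u j) with hj | hj <;>
      rcases Int.units_eq_one_or (u k) with hk | hk <;> rw [hi, hj, hk] <;> norm_num

theorem classicalValue_eq_expr (m : Obs n → ℤˣ) :
    classicalValue n m = expr n fun c => ((∏ a ∈ c, m a : ℤˣ) : ℤ) := by
  simp [classicalValue]

theorem tripleExpr_units_le_eight (m : Obs n → ℤˣ) {t : Finset (Fin n)} (ht : t.card = 3) :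
    tripleExpr (fun c => ((∏ a ∈ c, m a : ℤˣ) : ℤ)) t ≤ 8 := by
  have hle (u : ℤˣ) : ((u : ℤ) : ℝ) ≤ 1 := by
    rcases Int.units_eq_one_or u with rfl | rfl <;> norm_num
  have hedges := sum_le_card fun e (_ : e ∈ edgesIn t) => hle (∏ a ∈ ctxABN e, m a)
  have hpairs := sum_le_card fun j (_ : j ∈ t) => hle (∏ a ∈ ctxNN t j, m a)
  have hvertices := sum_sub_prod_le_two (fun i => ∏ a ∈ ctxAB {i}, m a) ht
  rw [← prod_ctxAB_eq_prod_prod m (ht ▸ by decide)] at hvertices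
  rw [card_edgesIn, ht, show Nat.choose 3 2 = 3 from rfl, Nat.cast_ofNat] at hedges
  rw [ht, Nat.cast_ofNat] at hpairs
  rw [tripleExpr]
  linarith

theorem tripleExpr_one {t : Finset (Fin n)} (ht : t.card = 3) : tripleExpr (fun _ => 1) t = 8 := by
  simp only [tripleExpr, Finset.sum_const, card_edgesIn, ht, nsmul_eq_mul, mul_one]
  norm_num

theorem isGreatest_classicalValue (hn : 2 ≤ n) :
    IsGreatest (Set.range (classicalValue n)) (etaC n) := by
  constructor
  · refine ⟨fun _ => 1, ?_⟩
    rw [classicalValue_eq_expr, expr_eq_sum_tripleExpr hn, etaC_eq_sum]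
    refine Finset.sum_congr rfl fun t ht => ?_
    simpa using tripleExpr_one (Finset.mem_powersetCard.1 ht).2
  · rintro _ ⟨m, rfl⟩
    rw [classicalValue_eq_expr, expr_eq_sum_tripleExpr hn, etaC_eq_sum]
    exact Finset.sum_le_sum fun t ht =>
      tripleExpr_units_le_eight m (Finset.mem_powersetCard.1 ht).2

end Classical

/-! ### Extremal realizations -/

section Extremal

variable {n : ℕ} {H : Type*} [NormedAddCommGroup H] [InnerProductSpace ℂ H] [CompleteSpace H]
  {ψ : H} {M : Obs n → H →L[ℂ] H}

/-- A realization all of whose correlators have the extremal value favoured by their coefficient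
in the expression, stated as operator identities on the state. -/
structure IsExtremal (ψ : H) (M : Obs n → H →L[ℂ] H) : Prop extends IsRealization ψ M where
  ABN : ∀ e, WordsAct ψ M (ctxABN e) 1
  AB_singleton : ∀ i, WordsAct ψ M (ctxAB {i}) 1
  AB_triple : ∀ t : Finset (Fin n), t.card = 3 → WordsAct ψ M (ctxAB t) (-1)
  NN : ∀ t : Finset (Fin n), t.card = 3 → ∀ j ∈ t, WordsAct ψ M (ctxNN t j) 1

variable (π : ∀ c : Finset (Obs n), PermScheme c)

theorem IsRealization.temporalValue_le_etaQ (h : IsRealization ψ M) (hn : 2 ≤ n) :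
    temporalValue π ψ M ≤ etaQ n :=
  expr_le_etaQ hn fun c => abs_piCorr_le_one h.isDichotomic h.norm_state (π c)

theorem IsRealization.temporalValue_eq_etaQ_iff (h : IsRealization ψ M) (hn : 3 ≤ n) :
    temporalValue π ψ M = etaQ n ↔ IsExtremal ψ M := by
  have hcorr (c : Finset (Obs n)) (ε : ℤˣ) :=
    piCorr_eq_unit_iff h.isDichotomic h.norm_state (π c) ε
  have hone c : piCorr (π c) ψ M = 1 ↔ WordsAct ψ M c 1 := by simpa using hcorr c 1
  have hneg c : piCorr (π c) ψ M = -1 ↔ WordsAct ψ M c (-1) := by simpa using hcorr c (-1)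
  rw [temporalValue,
    expr_eq_etaQ_iff hn fun c => abs_piCorr_le_one h.isDichotomic h.norm_state (π c)]
  simp only [hone, hneg]
  exact ⟨fun ⟨hABN, hAB, ht⟩ =>
      ⟨h, hABN, hAB, fun t hc => (ht t hc).1, fun t hc => (ht t hc).2⟩,
    fun hE => ⟨hE.ABN, hE.AB_singleton, fun t hc => ⟨hE.AB_triple t hc, hE.NN t hc⟩⟩⟩

end Extremal

section Contexts

variable {n : ℕ} {s : Finset (Fin n)}

theorem N_notMem_ctxAB {e : Edge n} : Obs.N e ∉ ctxAB s := by
  simp only [ctxAB, Finset.mem_image, Finset.mem_univ, true_and, not_exists]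
  intro k
  split_ifs <;> simp

/-- The edge between two distinct vertices. -/
def edge {i j : Fin n} (h : i ≠ j) : Edge n := ⟨s(i, j), h⟩

theorem mem_edge {i j k : Fin n} (h : i ≠ j) : k ∈ (edge h).1 ↔ k = i ∨ k = j :=
  Sym2.mem_iff

theorem exists_eq_edge (e : Edge n) : ∃ (i j : Fin n) (h : i ≠ j), e = edge h := by
  obtain ⟨e, he⟩ := e
  induction e using Sym2.ind with
  | _ i j => exact ⟨i, j, he, rfl⟩

theorem edge_comm {i j : Fin n} (h : i ≠ j) : edge h = edge h.symm :=
  Subtype.ext Sym2.eq_swap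

theorem edge_eq_edge_iff {i j k l : Fin n} (hij : i ≠ j) (hkl : k ≠ l) :
    edge hij = edge hkl ↔ i = k ∧ j = l ∨ i = l ∧ j = k :=
  Subtype.ext_iff.trans Sym2.eq_iff

theorem ctxNN_eq_pair {i j k : Fin n} (hij : i ≠ j) (hik : i ≠ k) :
    ctxNN {i, j, k} i = {Obs.N (edge hij), Obs.N (edge hik)} := by
  rw [ctxNN, ← Finset.image_singleton Obs.N, ← Finset.image_insert]
  congr 1
  ext e
  obtain ⟨x, y, hxy, rfl⟩ := exists_eq_edge e
  simp only [Finset.mem_filter, Finset.mem_univ, true_and, mem_edge, forall_eq_or_imp, forall_eq,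
    Finset.mem_insert, Finset.mem_singleton, edge_eq_edge_iff]
  grind

theorem IsOrdering.map {α β : Type*} [DecidableEq α] [DecidableEq β] {c : Finset α} {l : List α}
    (hl : IsOrdering c l) {f : α → β} (hf : Function.Injective f) :
    IsOrdering (c.image f) (l.map f) := by
  refine ⟨hl.1.map hf, ?_⟩
  rw [← hl.2]
  ext
  simp

theorem IsOrdering.insert {α : Type*} [DecidableEq α] {c : Finset α} {l l' : List α}
    (hl : IsOrdering c (l ++ l')) {a : α} (ha : a ∉ c) :
    IsOrdering (insert a c) (l ++ a :: l') := by
  refine IsOrdering.of_perm (l := a :: (l ++ l')) ⟨List.nodup_cons.2 ⟨?_, hl.1⟩, ?_⟩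
    List.perm_middle
  · rwa [← List.mem_toFinset, hl.2]
  · rw [List.toFinset_cons, hl.2]

theorem isOrdering_univ_iff {l : List (Fin n)} :
    IsOrdering Finset.univ l ↔ l.Nodup ∧ ∀ k, k ∈ l := by
  simp [IsOrdering, Finset.eq_univ_iff_forall]

end Contexts

/-! ### The action of the observables on `V_n` -/

section Words

variable {n : ℕ} {H : Type*} [NormedAddCommGroup H] [InnerProductSpace ℂ H]
  {ψ : H} {M : Obs n → H →L[ℂ] H}

/-- The word `∏_{k ∈ l} O_k` with `O_k = A_k` for `k ∈ s` and `O_k = B_k` for `k ∉ s`. -/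
def localWord (M : Obs n → H →L[ℂ] H) (s : Finset (Fin n)) (l : List (Fin n)) : H →L[ℂ] H :=
  (l.map fun k => M (localObs s k)).prod

theorem localWord_append_apply (s : Finset (Fin n)) (l l' : List (Fin n)) (v : H) :
    localWord M s (l ++ l') v = localWord M s l (localWord M s l' v) := by
  simp [localWord]

theorem localWord_cons_apply (s : Finset (Fin n)) (k : Fin n) (l : List (Fin n)) (v : H) :
    localWord M s (k :: l) v = M (localObs s k) (localWord M s l v) := by
  simp [localWord]

theorem localWord_nil_apply (s : Finset (Fin n)) (v : H) : localWord M s [] v = v := by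
  simp [localWord]

theorem localWord_congr {s s' : Finset (Fin n)} {l : List (Fin n)}
    (h : ∀ k ∈ l, (k ∈ s ↔ k ∈ s')) : localWord M s l = localWord M s' l := by
  unfold localWord
  congr 1
  exact List.map_congr_left fun k hk => by rw [localObs, localObs, if_congr (h k hk) rfl rfl]

/-- The elements of `s` in increasing order. -/
def ascending (s : Finset (Fin n)) : List (Fin n) :=
  (List.finRange n).filter (· ∈ s)

theorem mem_ascending {s : Finset (Fin n)} {k : Fin n} : k ∈ ascending s ↔ k ∈ s := by
  simp [ascending]

theorem nodup_ascending (s : Finset (Fin n)) : (ascending s).Nodup :=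
  (List.nodup_finRange n).filter _

theorem isOrdering_ascending (s : Finset (Fin n)) : IsOrdering s (ascending s) :=
  ⟨nodup_ascending s, by ext; simp [mem_ascending]⟩

/-- The operator `B_{i₁} ⋯ B_{iₖ}` for `s = {i₁ < ⋯ < iₖ}`. -/
def opB (M : Obs n → H →L[ℂ] H) (s : Finset (Fin n)) : H →L[ℂ] H :=
  localWord M ∅ (ascending s)

theorem wordB_eq_opB_apply (s : Finset (Fin n)) : wordB ψ M s = opB M s ψ := by
  simp [wordB, opB, localWord, localObs, ascending]

theorem wordB_empty : wordB ψ M ∅ = ψ := by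
  simp [wordB]

theorem localWord_ascending {s p : Finset (Fin n)} (h : Disjoint p s) :
    localWord M s (ascending p) = opB M p :=
  localWord_congr fun _ hk => by
    simpa using Finset.disjoint_left.1 h (mem_ascending.1 hk)

theorem isOrdering_univ_split {q : Finset (Fin n)} {i j : Fin n} (hij : i ≠ j) (hi : i ∉ q)
    (hj : j ∉ q) :
    IsOrdering Finset.univ (ascending ({i, j}ᶜ \ q) ++ i :: j :: ascending q) := by
  simp only [isOrdering_univ_iff, List.nodup_append, List.nodup_cons, List.mem_append,
    List.mem_cons, mem_ascending, nodup_ascending, Finset.mem_sdiff, Finset.mem_compl,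
    Finset.mem_insert, Finset.mem_singleton]
  grind

theorem localWord_pair_ascending {q : Finset (Fin n)} {i j : Fin n} (hi : i ∉ q) (hj : j ∉ q) :
    localWord M {i, j} (ascending q) = opB M q :=
  localWord_ascending (by simp [Finset.disjoint_right, hi, hj])

end Words

section Isometry

variable {H : Type*} [NormedAddCommGroup H] [InnerProductSpace ℂ H] [CompleteSpace H]
  {L : List (H →L[ℂ] H)}

theorem norm_prod_apply (hL : ∀ T ∈ L, IsDichotomic T) (v : H) : ‖L.prod v‖ = ‖v‖ := by
  induction L with
  | nil => simp
  | cons T L ih =>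
    obtain ⟨hT, hL⟩ := List.forall_mem_cons.1 hL
    rw [List.prod_cons, mul_apply_eq_comp, hT.norm_apply, ih hL]

/-- A product of dichotomic observables, as a linear isometry. -/
def prodIsometry (hL : ∀ T ∈ L, IsDichotomic T) : H →ₗᵢ[ℂ] H :=
  ⟨L.prod, norm_prod_apply hL⟩

theorem inner_prod_apply (hL : ∀ T ∈ L, IsDichotomic T) (v w : H) :
    inner ℂ (L.prod v) (L.prod w) = inner ℂ v w :=
  (prodIsometry hL).inner_map_map v w

theorem injective_prod (hL : ∀ T ∈ L, IsDichotomic T) : Function.Injective L.prod :=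
  (prodIsometry hL).injective

end Isometry

section WordsAct

variable {n : ℕ} {H : Type*} [NormedAddCommGroup H] [InnerProductSpace ℂ H]
  {ψ : H} {M : Obs n → H →L[ℂ] H} {ε : ℤˣ} {l l' : List (Fin n)}

theorem WordsAct.localWord_apply {s : Finset (Fin n)} (h : WordsAct ψ M (ctxAB s) ε)
    (hl : IsOrdering Finset.univ l) : localWord M s l ψ = ε • ψ := by
  rw [← h _ (hl.map (injective_localObs s)), List.map_map]
  rfl

theorem WordsAct.localWord_N_apply {i j : Fin n} {hij : i ≠ j}
    (h : WordsAct ψ M (ctxABN (edge hij)) ε) (hl : IsOrdering Finset.univ (l ++ l')) :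
    localWord M {i, j} l (M (.N (edge hij)) (localWord M {i, j} l' ψ)) = ε • ψ := by
  have hctx : ctxABN (edge hij) = insert (.N (edge hij)) (ctxAB {i, j}) := by
    rw [ctxABN]
    congr
    ext k
    simp [mem_edge]
  have hword : IsOrdering (ctxAB {i, j})
      (l.map (localObs {i, j}) ++ l'.map (localObs {i, j})) := by
    rw [← List.map_append]
    exact hl.map (injective_localObs {i, j})
  rw [← h _ (hctx ▸ hword.insert N_notMem_ctxAB)]
  simp [localWord, Function.comp_def]

end WordsAct

theorem exists_ne_ne {n : ℕ} (hn : 3 ≤ n) (i j : Fin n) : ∃ k, k ≠ i ∧ k ≠ j :=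
  ENat.exists_ne_ne_of_three_le (by simpa using hn) i j

/-- The sign `-1` if `i ∈ s` and `1` otherwise. -/
def memSign {n : ℕ} (i : Fin n) (s : Finset (Fin n)) : ℤˣ := if i ∈ s then -1 else 1

/-- The vectors `wordB ψ M s` are permuted up to sign by every observable `a`: this is the set by
which `s` is shifted. -/
def actionShift {n : ℕ} : Obs n → Finset (Fin n)
  | .A i => {i}ᶜ
  | .B i => {i}
  | .N _ => Finset.univ

/-- The sign with which the observable `a` maps `wordB ψ M s` to its shift. -/
def actionSign {n : ℕ} : Obs n → Finset (Fin n) → ℤˣ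
  | .A i, s => memSign i s
  | .B _, _ => 1
  | .N e, s => -∏ k ∈ e.1.toFinset, memSign k s

namespace IsExtremal

variable {n : ℕ} {H : Type*} [NormedAddCommGroup H] [InnerProductSpace ℂ H] [CompleteSpace H]
  {ψ : H} {M : Obs n → H →L[ℂ] H} {s q : Finset (Fin n)} {i j k : Fin n} {l l' : List (Fin n)}

theorem injective_localWord (hE : IsExtremal ψ M) (s : Finset (Fin n)) (l : List (Fin n)) :
    Function.Injective (localWord M s l) :=
  injective_prod (List.forall_mem_map.2 fun _ _ => hE.isDichotomic _)

theorem word_A_word (hE : IsExtremal ψ M) (hl : IsOrdering Finset.univ (l ++ i :: l')) :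
    localWord M ∅ l (M (.A i) (localWord M ∅ l' ψ)) = ψ := by
  have hword := (hE.AB_singleton i).localWord_apply hl
  have hnodup := List.nodup_middle.1 hl.1
  have hi : i ∉ l ++ l' := (List.nodup_cons.1 hnodup).1
  have hcongr {p : List (Fin n)} (hp : p ⊆ l ++ l') : localWord M {i} p = localWord M ∅ p :=
    localWord_congr fun k hk => by simpa using fun h : k = i => hi (hp (h ▸ hk))
  rw [localWord_append_apply, localWord_cons_apply, hcongr (List.subset_append_left l l'),
    hcongr (List.subset_append_right l l')] at hword
  simpa [localObs] using hword

theorem A_apply_state_eq_localWord (hE : IsExtremal ψ M) (hl : IsOrdering Finset.univ (i :: l)) :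
    M (.A i) ψ = localWord M ∅ l ψ := by
  rw [(hE.isDichotomic _).apply_eq_iff]
  simpa [localWord_nil_apply] using (hE.word_A_word (l := []) hl).symm

theorem N_apply_state_eq_neg_B_A (hE : IsExtremal ψ M) (hij : i ≠ j) (hik : i ≠ k) (hjk : j ≠ k) :
    M (.N (edge hij)) ψ = -M (.B k) (M (.A k) ψ) := by
  obtain ⟨p, hp⟩ : ∃ p, p = i :: j :: ascending {i, j, k}ᶜ := ⟨_, rfl⟩
  have hord : IsOrdering Finset.univ (p ++ [k]) := by
    simp only [hp, isOrdering_univ_iff, List.nodup_append, List.nodup_cons, List.mem_append,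
      List.mem_cons, mem_ascending, nodup_ascending, Finset.mem_compl, Finset.mem_insert,
      Finset.mem_singleton]
    grind
  have hk : k ∉ p := by simp [hp, mem_ascending, hik.symm, hjk.symm]
  have hcongr : localWord M {i, j, k} p = localWord M {i, j} p :=
    localWord_congr fun l hl => by simp [show l ≠ k from fun h => hk (h ▸ hl)]
  have htriple : localWord M {i, j} p (M (.A k) ψ) = -ψ := by
    have := (hE.AB_triple {i, j, k} (Finset.card_eq_three.2 ⟨i, j, k, hij, hik, hjk, rfl⟩)
      ).localWord_apply hord
    rw [localWord_append_apply, localWord_cons_apply, localWord_nil_apply, hcongr] at this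
    simpa [localObs] using this
  have hedge : localWord M {i, j} p (M (.B k) (M (.N (edge hij)) ψ)) = ψ := by
    have := (hE.ABN (edge hij)).localWord_N_apply (l := p ++ [k]) (l' := []) (by simpa using hord)
    rw [localWord_append_apply, localWord_cons_apply, localWord_nil_apply] at this
    simpa [localObs, hik.symm, hjk.symm, localWord_nil_apply] using this
  have hAB : M (.A k) ψ = -M (.B k) (M (.N (edge hij)) ψ) :=
    hE.injective_localWord {i, j} p (by rw [htriple, map_neg, hedge])
  rw [hAB, map_neg, neg_neg, (hE.isDichotomic _).apply_apply]

theorem N_edge_apply_state_eq (hE : IsExtremal ψ M) (hij : i ≠ j) (hik : i ≠ k) (hjk : j ≠ k) :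
    M (.N (edge hij)) ψ = M (.N (edge hik)) ψ := by
  have hpair := hE.NN {i, j, k} (Finset.card_eq_three.2 ⟨i, j, k, hij, hik, hjk, rfl⟩) i (by simp)
    [.N (edge hij), .N (edge hik)] ⟨by simp [edge_eq_edge_iff, hjk, hik], by
      rw [ctxNN_eq_pair hij hik]; simp⟩
  rw [(hE.isDichotomic _).apply_eq_iff]
  simpa using hpair.symm

theorem B_A_apply_state_eq (hE : IsExtremal ψ M) (hn : 3 ≤ n) (j k : Fin n) :
    M (.B j) (M (.A j) ψ) = M (.B k) (M (.A k) ψ) := by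
  rcases eq_or_ne j k with rfl | hjk
  · rfl
  obtain ⟨i, hij, hik⟩ := exists_ne_ne hn j k
  rw [← neg_inj, ← hE.N_apply_state_eq_neg_B_A hik hij hjk.symm,
    ← hE.N_apply_state_eq_neg_B_A hij hik hjk, hE.N_edge_apply_state_eq hij hik hjk]

theorem localWord_apply_state_eq (hE : IsExtremal ψ M) (hn : 3 ≤ n) (hl : IsOrdering s l)
    (hl' : IsOrdering s l') : localWord M ∅ l ψ = localWord M ∅ l' ψ := by
  rcases eq_or_ne s Finset.univ with rfl | hs
  · have hBA (p : List (Fin n)) (hp : IsOrdering Finset.univ p) :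
        localWord M ∅ p ψ = M (.B ⟨0, by omega⟩) (M (.A ⟨0, by omega⟩) ψ) := by
      obtain _ | ⟨k, p⟩ := p
      · simpa using (isOrdering_univ_iff.1 hp).2 ⟨0, by omega⟩
      · rw [localWord_cons_apply, ← hE.A_apply_state_eq_localWord hp, ← hE.B_A_apply_state_eq hn k]
        simp [localObs]
    rw [hBA l hl, hBA l' hl']
  · obtain ⟨i, hi⟩ : ∃ i, i ∉ s := by simpa [Finset.eq_univ_iff_forall] using hs
    have hextend (p : List (Fin n)) (hp : IsOrdering s p) :
        IsOrdering Finset.univ (i :: (ascending ({i}ᶜ \ s) ++ p)) := by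
      have hmem (k : Fin n) : k ∈ p ↔ k ∈ s := by rw [← hp.2, List.mem_toFinset]
      simp only [isOrdering_univ_iff, List.nodup_append, List.nodup_cons, List.mem_append,
        List.mem_cons, mem_ascending, nodup_ascending, Finset.mem_compl, Finset.mem_sdiff,
        Finset.mem_singleton, hmem]
      grind [hp.1]
    apply hE.injective_localWord ∅ (ascending ({i}ᶜ \ s))
    rw [← localWord_append_apply, ← localWord_append_apply,
      ← hE.A_apply_state_eq_localWord (hextend l hl),
      ← hE.A_apply_state_eq_localWord (hextend l' hl')]

theorem localWord_apply_state (hE : IsExtremal ψ M) (hn : 3 ≤ n) (hl : IsOrdering s l) :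
    localWord M ∅ l ψ = wordB ψ M s := by
  rw [wordB_eq_opB_apply]
  exact hE.localWord_apply_state_eq hn hl (isOrdering_ascending s)

theorem B_apply_wordB (hE : IsExtremal ψ M) (hn : 3 ≤ n) (i : Fin n) (s : Finset (Fin n)) :
    M (.B i) (wordB ψ M s) = wordB ψ M (symmDiff {i} s) := by
  have hnotMem {s : Finset (Fin n)} (hi : i ∉ s) :
      M (.B i) (wordB ψ M s) = wordB ψ M (insert i s) := by
    rw [← hE.localWord_apply_state hn
      (IsOrdering.insert (l := []) (l' := ascending s) (isOrdering_ascending s) hi),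
      List.nil_append, localWord_cons_apply, wordB_eq_opB_apply, opB, localObs,
      if_neg (Finset.notMem_empty i)]
  by_cases hi : i ∈ s
  · rw [(hE.isDichotomic _).apply_eq_iff, hnotMem (by simp [Finset.mem_symmDiff, hi])]
    congr 1
    ext k
    simp only [Finset.mem_insert, Finset.mem_symmDiff, Finset.mem_singleton]
    grind
  · rw [hnotMem hi]
    congr 1
    ext k
    simp only [Finset.mem_insert, Finset.mem_symmDiff, Finset.mem_singleton]
    grind

theorem opB_apply_wordB (hE : IsExtremal ψ M) (hn : 3 ≤ n) (p s : Finset (Fin n)) :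
    opB M p (wordB ψ M s) = wordB ψ M (symmDiff p s) := by
  have hword (l : List (Fin n)) (hl : l.Nodup) :
      localWord M ∅ l (wordB ψ M s) = wordB ψ M (symmDiff l.toFinset s) := by
    induction l with
    | nil => simp [localWord_nil_apply, ← Finset.bot_eq_empty]
    | cons i l ih =>
      obtain ⟨hi, hl⟩ := List.nodup_cons.1 hl
      have hunion : symmDiff {i} l.toFinset = (i :: l).toFinset := by
        rw [List.toFinset_cons, Finset.insert_eq]
        exact (Finset.disjoint_singleton_left.2 (by simpa using hi)).symmDiff_eq_sup
      rw [localWord_cons_apply, ih hl, ← hunion, symmDiff_assoc, ← hE.B_apply_wordB hn]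
      simp [localObs]
  rw [opB, hword _ (nodup_ascending p), (isOrdering_ascending p).2]

theorem eq_smul_wordB_of_opB_apply (hE : IsExtremal ψ M) (hn : 3 ≤ n) {p : Finset (Fin n)} {v : H}
    {ε : ℤˣ} (h : opB M p v = ε • wordB ψ M s) : v = ε • wordB ψ M (symmDiff p s) := by
  apply hE.injective_localWord ∅ (ascending p)
  rw [← opB, h, map_zsmul_unit, hE.opB_apply_wordB hn, symmDiff_symmDiff_cancel_left]

theorem A_apply_wordB_of_notMem (hE : IsExtremal ψ M) (hn : 3 ≤ n) (hi : i ∉ s) :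
    M (.A i) (wordB ψ M s) = wordB ψ M (symmDiff {i}ᶜ s) := by
  have hord : IsOrdering Finset.univ (ascending ({i}ᶜ \ s) ++ i :: ascending s) := by
    simp only [isOrdering_univ_iff, List.nodup_append, List.nodup_cons, List.mem_append,
      List.mem_cons, mem_ascending, nodup_ascending, Finset.mem_sdiff, Finset.mem_compl,
      Finset.mem_singleton]
    grind
  have hword : opB M ({i}ᶜ \ s) (M (.A i) (wordB ψ M s)) = (1 : ℤˣ) • wordB ψ M ∅ := by
    rw [one_smul, wordB_empty, wordB_eq_opB_apply]
    exact hE.word_A_word hord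
  rw [hE.eq_smul_wordB_of_opB_apply hn hword, one_smul]
  congr 1
  ext k
  simp only [Finset.mem_symmDiff, Finset.mem_sdiff, Finset.mem_compl, Finset.mem_singleton,
    Finset.notMem_empty]
  grind

theorem N_opB_A_A (hE : IsExtremal ψ M) (hij : i ≠ j) (hi : i ∉ q) (hj : j ∉ q) :
    M (.N (edge hij)) (opB M ({i, j}ᶜ \ q) (M (.A i) (M (.A j) (wordB ψ M q)))) = ψ := by
  have hword := (hE.ABN (edge hij)).localWord_N_apply (l := [])
    (l' := ascending ({i, j}ᶜ \ q) ++ i :: j :: ascending q) (isOrdering_univ_split hij hi hj)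
  rw [localWord_nil_apply, localWord_append_apply, localWord_cons_apply, localWord_cons_apply,
    localWord_pair_ascending hi hj, localWord_pair_ascending (by simp) (by simp),
    one_smul] at hword
  simpa [localObs, wordB_eq_opB_apply] using hword

theorem A_opB_N_A (hE : IsExtremal ψ M) (hij : i ≠ j) (hi : i ∉ q) (hj : j ∉ q) :
    M (.A i) (opB M ({i, j}ᶜ \ q) (M (.N (edge hij)) (M (.A j) (wordB ψ M q)))) = ψ := by
  have hword := (hE.ABN (edge hij)).localWord_N_apply (l := i :: ascending ({i, j}ᶜ \ q))
    (l' := j :: ascending q) ((isOrdering_univ_split hij hi hj).of_perm List.perm_middle.symm)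
  rw [localWord_cons_apply, localWord_cons_apply,
    localWord_pair_ascending hi hj, localWord_pair_ascending (by simp) (by simp),
    one_smul] at hword
  simpa [localObs, wordB_eq_opB_apply] using hword

theorem A_A_opB_N (hE : IsExtremal ψ M) (hij : i ≠ j) (hi : i ∉ q) (hj : j ∉ q) :
    M (.A i) (M (.A j) (opB M ({i, j}ᶜ \ q) (M (.N (edge hij)) (wordB ψ M q)))) = ψ := by
  have hword := (hE.ABN (edge hij)).localWord_N_apply (l := i :: j :: ascending ({i, j}ᶜ \ q))
    (l' := ascending q) ((isOrdering_univ_split hij hi hj).of_perm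
      ((List.perm_middle.symm.cons i).trans List.perm_middle.symm))
  rw [localWord_cons_apply, localWord_cons_apply,
    localWord_pair_ascending hi hj, localWord_pair_ascending (by simp) (by simp),
    one_smul] at hword
  simpa [localObs, wordB_eq_opB_apply] using hword

theorem A_apply_state_eq_wordB (hE : IsExtremal ψ M) (hn : 3 ≤ n) (i : Fin n) :
    M (.A i) ψ = wordB ψ M {i}ᶜ := by
  have hA := hE.A_apply_wordB_of_notMem hn (Finset.notMem_empty i)
  rwa [wordB_empty, ← Finset.bot_eq_empty, symmDiff_bot] at hA

theorem N_apply_state_eq_neg_wordB (hE : IsExtremal ψ M) (hn : 3 ≤ n) (e : Edge n) :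
    M (.N e) ψ = -wordB ψ M Finset.univ := by
  obtain ⟨i, j, hij, rfl⟩ := exists_eq_edge e
  obtain ⟨k, hki, hkj⟩ := exists_ne_ne hn i j
  rw [hE.N_apply_state_eq_neg_B_A hij hki.symm hkj.symm, hE.A_apply_state_eq_wordB hn,
    hE.B_apply_wordB hn,
    symmDiff_compl_self, Finset.top_eq_univ]

theorem A_apply_wordB_of_mem (hE : IsExtremal ψ M) (hn : 3 ≤ n) (hi : i ∈ s) :
    M (.A i) (wordB ψ M s) = -wordB ψ M (symmDiff {i}ᶜ s) := by
  have hproper {s : Finset (Fin n)} (hi : i ∈ s) (hs : s ≠ Finset.univ) :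
      M (.A i) (wordB ψ M s) = -wordB ψ M (symmDiff {i}ᶜ s) := by
    obtain ⟨j, hj⟩ : ∃ j, j ∉ s := by simpa [Finset.eq_univ_iff_forall] using hs
    have hij : i ≠ j := fun h => hj (h ▸ hi)
    have hword := hE.N_opB_A_A hij (q := symmDiff {j}ᶜ s) (by simp [Finset.mem_symmDiff, hi, hij])
      (by simp [Finset.mem_symmDiff, hj])
    rw [← hE.A_apply_wordB_of_notMem hn hj, (hE.isDichotomic _).apply_apply,
      (hE.isDichotomic _).apply_eq_iff, hE.N_apply_state_eq_neg_wordB hn,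
      ← one_smul ℤˣ (wordB ψ M Finset.univ), ← Units.neg_smul] at hword
    rw [hE.eq_smul_wordB_of_opB_apply hn hword, Units.neg_smul, one_smul]
    congr 2
    ext k
    simp only [Finset.mem_symmDiff, Finset.mem_sdiff, Finset.mem_compl, Finset.mem_insert,
      Finset.mem_singleton, Finset.mem_univ]
    grind
  rcases eq_or_ne s Finset.univ with rfl | hs
  · have hcompl : symmDiff {i}ᶜ {i} = (Finset.univ : Finset (Fin n)) := compl_symmDiff_self _
    have hne : {i} ≠ (Finset.univ : Finset (Fin n)) := fun h => by
      simpa [← h] using hn.trans_eq (Finset.card_fin n).symm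
    have hsingle : M (.A i) (wordB ψ M {i}) = -wordB ψ M Finset.univ := by
      rw [hproper (Finset.mem_singleton_self i) hne, hcompl]
    have hshift : symmDiff {i}ᶜ Finset.univ = {i} := by
      rw [← hcompl, symmDiff_symmDiff_cancel_left]
    rw [hshift, (hE.isDichotomic _).apply_eq_iff, map_neg, hsingle, neg_neg]
  · exact hproper hi hs

theorem A_apply_wordB (hE : IsExtremal ψ M) (hn : 3 ≤ n) (i : Fin n) (s : Finset (Fin n)) :
    M (.A i) (wordB ψ M s) = memSign i s • wordB ψ M (symmDiff {i}ᶜ s) := by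
  by_cases hi : i ∈ s
  · rw [hE.A_apply_wordB_of_mem hn hi, memSign, if_pos hi, Units.neg_smul, one_smul]
  · rw [hE.A_apply_wordB_of_notMem hn hi, memSign, if_neg hi, one_smul]

theorem N_apply_wordB_of_notMem_notMem (hE : IsExtremal ψ M) (hn : 3 ≤ n) (hij : i ≠ j)
    (hi : i ∉ s) (hj : j ∉ s) : M (.N (edge hij)) (wordB ψ M s) = -wordB ψ M sᶜ := by
  have hword := hE.A_A_opB_N hij hi hj
  rw [(hE.isDichotomic _).apply_eq_iff, (hE.isDichotomic _).apply_eq_iff,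
    hE.A_apply_state_eq_wordB hn, hE.A_apply_wordB hn, memSign,
    if_pos (by simpa using hij.symm)] at hword
  rw [hE.eq_smul_wordB_of_opB_apply hn hword, Units.neg_smul, one_smul]
  congr 2
  ext k
  simp only [Finset.mem_symmDiff, Finset.mem_sdiff, Finset.mem_compl, Finset.mem_insert,
    Finset.mem_singleton]
  grind

theorem N_apply_wordB_of_mem_notMem (hE : IsExtremal ψ M) (hn : 3 ≤ n) (hij : i ≠ j)
    (hi : i ∈ s) (hj : j ∉ s) : M (.N (edge hij)) (wordB ψ M s) = wordB ψ M sᶜ := by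
  have hword := hE.A_opB_N_A hij (q := symmDiff {j}ᶜ s) (by simp [Finset.mem_symmDiff, hi, hij])
    (by simp [Finset.mem_symmDiff, hj])
  rw [← hE.A_apply_wordB_of_notMem hn hj, (hE.isDichotomic _).apply_apply,
    (hE.isDichotomic _).apply_eq_iff, hE.A_apply_state_eq_wordB hn,
    ← one_smul ℤˣ (wordB ψ M {i}ᶜ)] at hword
  rw [hE.eq_smul_wordB_of_opB_apply hn hword, one_smul]
  congr 1
  ext k
  simp only [Finset.mem_symmDiff, Finset.mem_sdiff, Finset.mem_compl, Finset.mem_insert,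
    Finset.mem_singleton]
  grind

theorem N_apply_wordB (hE : IsExtremal ψ M) (hn : 3 ≤ n) (e : Edge n) (s : Finset (Fin n)) :
    M (.N e) (wordB ψ M s) = -(∏ k ∈ e.1.toFinset, memSign k s) • wordB ψ M sᶜ := by
  obtain ⟨i, j, hij, rfl⟩ := exists_eq_edge e
  have hprod : ∏ k ∈ (edge hij).1.toFinset, memSign k s = memSign i s * memSign j s := by
    rw [edge, Sym2.toFinset_mk_eq, Finset.prod_pair hij]
  rw [hprod]
  by_cases hi : i ∈ s <;> by_cases hj : j ∈ s <;> simp only [memSign, hi, hj, if_true, if_false]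
  · have hcompl := hE.N_apply_wordB_of_notMem_notMem hn hij (s := sᶜ) (by simpa) (by simpa)
    rw [compl_compl] at hcompl
    rw [(hE.isDichotomic _).apply_eq_iff]
    simp [hcompl]
  · simp [hE.N_apply_wordB_of_mem_notMem hn hij hi hj]
  · simp [edge_comm hij, hE.N_apply_wordB_of_mem_notMem hn hij.symm hj hi]
  · simp [hE.N_apply_wordB_of_notMem_notMem hn hij hi hj]

theorem apply_wordB (hE : IsExtremal ψ M) (hn : 3 ≤ n) (a : Obs n) (s : Finset (Fin n)) :
    M a (wordB ψ M s) = actionSign a s • wordB ψ M (symmDiff (actionShift a) s) := by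
  cases a with
  | A i => exact hE.A_apply_wordB hn i s
  | B i => rw [hE.B_apply_wordB hn, actionSign, actionShift, one_smul]
  | N e => rw [hE.N_apply_wordB hn, actionSign, actionShift, ← Finset.top_eq_univ,
      top_symmDiff, hnot_eq_compl]

/-! ### The dimension of `V_n` -/

theorem norm_wordB (hE : IsExtremal ψ M) (s : Finset (Fin n)) : ‖wordB ψ M s‖ = 1 := by
  rw [wordB, norm_prod_apply (List.forall_mem_map.2 fun _ _ => hE.isDichotomic _), hE.norm_state]

/-- The stabilizing operators `A_i ∏_{k ≠ i} B_k` separate the words by their eigenvalues. -/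
theorem inner_wordB_eq_zero (hE : IsExtremal ψ M) (hn : 3 ≤ n) {t : Finset (Fin n)} (hi : i ∈ s)
    (hit : i ∉ t) : inner ℂ (wordB ψ M s) (wordB ψ M t) = 0 := by
  let G : List (H →L[ℂ] H) := M (.A i) :: (ascending {i}ᶜ).map fun k => M (localObs ∅ k)
  have hG : ∀ T ∈ G, IsDichotomic T := by
    simp only [G, List.forall_mem_cons, List.forall_mem_map, hE.isDichotomic, implies_true,
      and_self]
  have heigen (s : Finset (Fin n)) : G.prod (wordB ψ M s) = memSign i s • wordB ψ M s := by
    have hsign : memSign i (symmDiff {i}ᶜ s) = memSign i s := by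
      simp [memSign, Finset.mem_symmDiff]
    rw [List.prod_cons, mul_apply_eq_comp, ← localWord, ← opB, hE.opB_apply_wordB hn,
      hE.A_apply_wordB hn, symmDiff_symmDiff_cancel_left, hsign]
  have hneg := inner_prod_apply hG (wordB ψ M s) (wordB ψ M t)
  rw [heigen, heigen, memSign, memSign, if_pos hi, if_neg hit, Units.neg_smul, one_smul, one_smul,
    inner_neg_left] at hneg
  exact self_eq_neg.1 hneg.symm

theorem orthonormal_wordB (hE : IsExtremal ψ M) (hn : 3 ≤ n) : Orthonormal ℂ (wordB ψ M) := by
  refine ⟨hE.norm_wordB, fun s t hst => ?_⟩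
  obtain ⟨i, hi⟩ := Finset.symmDiff_nonempty.2 hst
  rcases Finset.mem_symmDiff.1 hi with ⟨his, hit⟩ | ⟨hit, his⟩
  · exact hE.inner_wordB_eq_zero hn his hit
  · exact inner_eq_zero_symm.1 (hE.inner_wordB_eq_zero hn hit his)

end IsExtremal

/-! ### Uniqueness of extremal realizations -/

section Uniqueness

variable {n : ℕ} {H : Type*} [NormedAddCommGroup H] [InnerProductSpace ℂ H]
  {ψ : H} {M : Obs n → H →L[ℂ] H}

theorem wordB_mem_invSubspace (s : Finset (Fin n)) : wordB ψ M s ∈ invSubspace ψ M :=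
  Submodule.subset_span ⟨s, rfl⟩

theorem state_mem_invSubspace : ψ ∈ invSubspace ψ M := by
  simpa only [wordB_empty] using wordB_mem_invSubspace (ψ := ψ) (M := M) ∅

namespace IsExtremal

variable [CompleteSpace H]

theorem apply_mem_invSubspace (hE : IsExtremal ψ M) (hn : 3 ≤ n) (a : Obs n) {v : H}
    (hv : v ∈ invSubspace ψ M) : M a v ∈ invSubspace ψ M := by
  suffices invSubspace ψ M ≤ (invSubspace ψ M).comap (M a).toLinearMap from this hv
  refine Submodule.span_le.2 (Set.range_subset_iff.2 fun s => ?_)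
  change M a (wordB ψ M s) ∈ invSubspace ψ M
  rw [hE.apply_wordB hn, Units.smul_def]
  exact zsmul_mem (wordB_mem_invSubspace _) _

/-- The vectors `B_{i₁} ⋯ B_{iₖ} ψ` as an orthonormal basis of `V_n`. -/
def basis (hE : IsExtremal ψ M) (hn : 3 ≤ n) :
    OrthonormalBasis (Finset (Fin n)) ℂ (invSubspace ψ M) :=
  OrthonormalBasis.mk (v := fun s => (⟨wordB ψ M s, wordB_mem_invSubspace s⟩ : invSubspace ψ M))
    ((invSubspace ψ M).subtypeₗᵢ.orthonormal_comp_iff.1 (hE.orthonormal_wordB hn)) <| by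
      rintro ⟨v, hv⟩ -
      rw [← Submodule.apply_mem_span_image_iff_mem_span (Submodule.injective_subtype _),
        ← Set.range_comp]
      exact hv

theorem coe_basis (hE : IsExtremal ψ M) (hn : 3 ≤ n) (s : Finset (Fin n)) :
    (hE.basis hn s : H) = wordB ψ M s := by
  rw [basis, OrthonormalBasis.coe_mk]

theorem finrank_invSubspace (hE : IsExtremal ψ M) (hn : 3 ≤ n) :
    Module.finrank ℂ (invSubspace ψ M) = 2 ^ n := by
  rw [Module.finrank_eq_card_basis (hE.basis hn).toBasis, Fintype.card_finset, Fintype.card_fin]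

theorem two_pow_le_rank (hE : IsExtremal ψ M) (hn : 3 ≤ n) :
    (2 ^ n : Cardinal) ≤ Module.rank ℂ H := by
  calc (2 ^ n : Cardinal) = Module.rank ℂ (invSubspace ψ M) := by
        rw [← Module.finrank_eq_rank, hE.finrank_invSubspace hn, Nat.cast_pow, Nat.cast_ofNat]
    _ ≤ Module.rank ℂ H := Submodule.rank_le _

variable {H' : Type*} [NormedAddCommGroup H'] [InnerProductSpace ℂ H'] [CompleteSpace H']
  {ψ' : H'} {M' : Obs n → H' →L[ℂ] H'}

/-- The unitary `B_{i₁} ⋯ B_{iₖ} ψ ↦ B'_{i₁} ⋯ B'_{iₖ} ψ'` between the subspaces `V_n` of two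
extremal realizations. -/
def unitary (hE : IsExtremal ψ M) (hE' : IsExtremal ψ' M') (hn : 3 ≤ n) :
    invSubspace ψ M ≃ₗᵢ[ℂ] invSubspace ψ' M' :=
  (hE.basis hn).equiv (hE'.basis hn) (Equiv.refl _)

theorem unitary_basis (hE : IsExtremal ψ M) (hE' : IsExtremal ψ' M') (hn : 3 ≤ n)
    (s : Finset (Fin n)) : hE.unitary hE' hn (hE.basis hn s) = hE'.basis hn s := by
  rw [unitary, OrthonormalBasis.equiv_apply_basis, Equiv.refl_apply]

theorem coe_unitary_state (hE : IsExtremal ψ M) (hE' : IsExtremal ψ' M') (hn : 3 ≤ n) :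
    (hE.unitary hE' hn ⟨ψ, state_mem_invSubspace⟩ : H') = ψ' := by
  have hbasis : (⟨ψ, state_mem_invSubspace⟩ : invSubspace ψ M) = hE.basis hn ∅ :=
    Subtype.ext (by rw [hE.coe_basis, wordB_empty])
  rw [hbasis, hE.unitary_basis, hE'.coe_basis, wordB_empty]

theorem restrict_apply_basis (hE : IsExtremal ψ M) (hn : 3 ≤ n) (a : Obs n)
    (s : Finset (Fin n)) :
    (M a).toLinearMap.restrict (fun _ => hE.apply_mem_invSubspace hn a) (hE.basis hn s) =
      actionSign a s • hE.basis hn (symmDiff (actionShift a) s) := by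
  apply (invSubspace ψ M).injective_subtype
  rw [map_zsmul_unit]
  simp [hE.coe_basis, hE.apply_wordB hn]

theorem coe_unitary_apply (hE : IsExtremal ψ M) (hE' : IsExtremal ψ' M') (hn : 3 ≤ n)
    (a : Obs n) (v : invSubspace ψ M) :
    (hE.unitary hE' hn ⟨M a v, hE.apply_mem_invSubspace hn a v.2⟩ : H') =
      M' a (hE.unitary hE' hn v) := by
  let U := (hE.unitary hE' hn).toLinearEquiv.toLinearMap
  have hmaps : U ∘ₗ (M a).toLinearMap.restrict (fun _ => hE.apply_mem_invSubspace hn a) =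
      (M' a).toLinearMap.restrict (fun _ => hE'.apply_mem_invSubspace hn a) ∘ₗ U := by
    have hU (s : Finset (Fin n)) : U (hE.basis hn s) = hE'.basis hn s := hE.unitary_basis hE' hn s
    refine (hE.basis hn).toBasis.ext fun s => ?_
    rw [OrthonormalBasis.coe_toBasis, LinearMap.comp_apply, LinearMap.comp_apply,
      hE.restrict_apply_basis, map_zsmul_unit, hU, hU, hE'.restrict_apply_basis]
  exact congrArg Subtype.val (LinearMap.congr_fun hmaps v)

theorem exists_unitary_of_invSubspace_eq_top (hE : IsExtremal ψ M) (hE' : IsExtremal ψ' M')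
    (hn : 3 ≤ n) (htop : invSubspace ψ' M' = ⊤) :
    ∃ U : invSubspace ψ M ≃ₗᵢ[ℂ] H',
      (∀ a φ, U ((invSubspace ψ M).orthogonalProjectionOnto
        (M a ((invSubspace ψ M).subtypeL (U.symm φ)))) = M' a φ) ∧
      U ((invSubspace ψ M).orthogonalProjectionOnto ψ) = ψ' := by
  let U := (hE.unitary hE' hn).trans (LinearIsometryEquiv.ofTop _ _ htop)
  have hproj (v : invSubspace ψ M) : (invSubspace ψ M).orthogonalProjectionOnto v = v :=
    Submodule.orthogonalProjectionOnto_mem_subspace_eq_self v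
  have hstate : U ⟨ψ, state_mem_invSubspace⟩ = ψ' := hE.coe_unitary_state hE' hn
  have hobs (a : Obs n) (v : invSubspace ψ M) :
      U ⟨M a v, hE.apply_mem_invSubspace hn a v.2⟩ = M' a (U v) :=
    hE.coe_unitary_apply hE' hn a v
  refine ⟨U, fun a φ => ?_, ?_⟩
  · have hφ := hobs a (U.symm φ)
    rwa [← hproj ⟨M a (U.symm φ), _⟩, U.apply_symm_apply] at hφ
  · rwa [← hproj ⟨ψ, state_mem_invSubspace⟩] at hstate

end IsExtremal

end Uniqueness

/-! ### Tensor products of Pauli matrices -/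

section Tensor

variable {n : ℕ}

/-- `K ↦ K₁ ⊗ ⋯ ⊗ Kₙ` as a monoid homomorphism. -/
def tensorHom : (Fin n → Matrix (Fin 2) (Fin 2) ℂ) →* (Qubits n →L[ℂ] Qubits n) where
  toFun := tensorOp
  map_one' := by
    rw [tensorOp, ← map_one (Matrix.toEuclideanCLM (n := Fin n → Fin 2) (𝕜 := ℂ))]
    congr 1
    ext x y
    simp only [Matrix.of_apply, Pi.one_apply, Matrix.one_apply]
    rw [Finset.prod_ite_zero]
    simp [funext_iff]
  map_mul' K L := by
    simp only [tensorOp]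
    rw [← map_mul (Matrix.toEuclideanCLM (n := Fin n → Fin 2) (𝕜 := ℂ))]
    congr 1
    ext x y
    simp only [Matrix.of_apply, Pi.mul_apply, Matrix.mul_apply, ← Finset.prod_mul_distrib]
    rw [Finset.prod_univ_sum, Fintype.piFinset_univ]

theorem tensorOp_mul (K L : Fin n → Matrix (Fin 2) (Fin 2) ℂ) :
    tensorOp K * tensorOp L = tensorOp (K * L) :=
  (map_mul tensorHom K L).symm

theorem tensorOp_one : tensorOp (1 : Fin n → Matrix (Fin 2) (Fin 2) ℂ) = 1 :=
  map_one tensorHom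

theorem tensorOp_smul (c : Fin n → ℂ) (K : Fin n → Matrix (Fin 2) (Fin 2) ℂ) :
    tensorOp (fun k => c k • K k) = (∏ k, c k) • tensorOp K := by
  rw [tensorOp, tensorOp, ← map_smul]
  congr 1
  ext x y
  simp [Finset.prod_mul_distrib]

theorem isSelfAdjoint_tensorOp {K : Fin n → Matrix (Fin 2) (Fin 2) ℂ}
    (hK : ∀ k, (K k).IsHermitian) : IsSelfAdjoint (tensorOp K) := by
  rw [IsSelfAdjoint, tensorOp, ← map_star]
  congr 1
  ext x y
  simp only [Matrix.star_apply, Matrix.of_apply, star_prod]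
  exact Finset.prod_congr rfl fun k _ => (hK k).apply _ _

theorem pauliX_mul_self : pauliX * pauliX = 1 := by
  simp [pauliX, Matrix.one_fin_two]

theorem pauliZ_mul_self : pauliZ * pauliZ = 1 := by
  simp [pauliZ, Matrix.one_fin_two]

theorem pauliZ_mul_pauliX : pauliZ * pauliX = -(pauliX * pauliZ) := by
  simp [pauliZ, pauliX]

theorem isHermitian_pauliX : pauliX.IsHermitian := by
  ext i j
  fin_cases i <;> fin_cases j <;> simp [pauliX]

theorem isHermitian_pauliZ : pauliZ.IsHermitian := by
  ext i j
  fin_cases i <;> fin_cases j <;> simp [pauliZ]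

/-- The tensor factors of the reference observables. -/
def pauliFactor : Obs n → Fin n → Matrix (Fin 2) (Fin 2) ℂ
  | .A i => fun k => if k = i then pauliX else 1
  | .B i => fun k => if k = i then pauliZ else 1
  | .N e => fun k => if k ∈ e.1 then pauliX else pauliZ

theorem pauliObs_eq_tensorOp (a : Obs n) : pauliObs a = tensorOp (pauliFactor a) := by
  cases a <;> rfl

theorem pauliFactor_cases (a : Obs n) (k : Fin n) :
    pauliFactor a k = 1 ∨ pauliFactor a k = pauliX ∨ pauliFactor a k = pauliZ := by
  cases a <;> simp only [pauliFactor] <;> split_ifs <;> simp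

theorem isSelfAdjoint_pauliObs (a : Obs n) : IsSelfAdjoint (pauliObs a) := by
  rw [pauliObs_eq_tensorOp]
  refine isSelfAdjoint_tensorOp fun k => ?_
  rcases pauliFactor_cases a k with h | h | h <;> rw [h]
  · exact Matrix.isHermitian_one
  · exact isHermitian_pauliX
  · exact isHermitian_pauliZ

theorem pauliObs_mul_self (a : Obs n) : pauliObs a * pauliObs a = 1 := by
  rw [pauliObs_eq_tensorOp, tensorOp_mul, ← tensorOp_one]
  congr 1
  ext1 k
  rcases pauliFactor_cases a k with h | h | h <;>
    simp [h, pauliX_mul_self, pauliZ_mul_self]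

theorem prod_map_pauliObs (w : List (Obs n)) :
    (w.map pauliObs).prod = tensorOp fun k => (w.map fun a => pauliFactor a k).prod := by
  have hfactor : (fun k => (w.map fun a => pauliFactor a k).prod) = (w.map pauliFactor).prod :=
    funext fun k => by rw [Pi.list_prod_apply, List.map_map, Function.comp_def]
  rw [hfactor]
  change _ = tensorHom _
  rw [map_list_prod, List.map_map]
  congr 2
  exact funext pauliObs_eq_tensorOp

/-- The tensor factors of `∏_{i ∈ s} X_i ∏_{k ∉ s} Z_k`. -/
def localFactor (s : Finset (Fin n)) (k : Fin n) : Matrix (Fin 2) (Fin 2) ℂ :=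
  if k ∈ s then pauliX else pauliZ

theorem localFactor_mul_self (s : Finset (Fin n)) (k : Fin n) :
    localFactor s k * localFactor s k = 1 := by
  unfold localFactor
  split_ifs
  · exact pauliX_mul_self
  · exact pauliZ_mul_self

theorem pauliFactor_localObs (s : Finset (Fin n)) (i k : Fin n) :
    pauliFactor (localObs s i) k = if k = i then localFactor s k else 1 := by
  unfold localObs localFactor
  split_ifs <;> simp_all [pauliFactor]

theorem IsOrdering.prod_map_eq_pow {α R : Type*} [DecidableEq α] [Monoid R] {c : Finset α}
    {l : List α} (hl : IsOrdering c l) {f : α → R} {x : R} {m : α → ℕ}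
    (hf : ∀ a ∈ c, f a = x ^ m a) : (l.map f).prod = x ^ ∑ a ∈ c, m a := by
  obtain ⟨hnodup, rfl⟩ := hl
  rw [List.sum_toFinset m hnodup]
  induction l with
  | nil => simp
  | cons a l ih =>
    have hf' : ∀ b ∈ a :: l, f b = x ^ m b := fun b hb => hf b (List.mem_toFinset.2 hb)
    rw [List.map_cons, List.prod_cons, List.map_cons, List.sum_cons, pow_add,
      hf' a List.mem_cons_self,
      ih (List.nodup_cons.1 hnodup).2 fun b hb =>
        hf' b (List.mem_cons_of_mem a (List.mem_toFinset.1 hb))]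

theorem pauliFactor_eq_pow_of_mem_ctxAB {s : Finset (Fin n)} {a : Obs n} (ha : a ∈ ctxAB s)
    (k : Fin n) :
    pauliFactor a k = localFactor s k ^ (if a = localObs s k then 1 else 0) := by
  obtain ⟨i, -, rfl⟩ := Finset.mem_image.1 ha
  change pauliFactor (localObs s i) k = localFactor s k ^ (if localObs s i = _ then 1 else 0)
  rw [pauliFactor_localObs, if_congr (injective_localObs s).eq_iff rfl rfl, pow_ite, pow_one,
    pow_zero, if_congr eq_comm rfl rfl]

theorem sum_ctxAB_localObs (s : Finset (Fin n)) (k : Fin n) :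
    ∑ a ∈ ctxAB s, (if a = localObs s k then 1 else 0) = 1 := by
  have hmem : localObs s k ∈ ctxAB s := Finset.mem_image_of_mem _ (Finset.mem_univ k)
  rw [Finset.sum_ite_eq', if_pos hmem]

theorem prod_map_pauliObs_ctxAB {s : Finset (Fin n)} {w : List (Obs n)}
    (hw : IsOrdering (ctxAB s) w) : (w.map pauliObs).prod = tensorOp (localFactor s) := by
  rw [prod_map_pauliObs]
  congr 1
  ext1 k
  rw [hw.prod_map_eq_pow fun a ha => pauliFactor_eq_pow_of_mem_ctxAB ha k,
    sum_ctxAB_localObs, pow_one]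

theorem prod_map_pauliObs_ctxABN {e : Edge n} {w : List (Obs n)} (hw : IsOrdering (ctxABN e) w) :
    (w.map pauliObs).prod = 1 := by
  let s : Finset (Fin n) := Finset.univ.filter fun k => k ∈ e.1
  have hN (k : Fin n) : pauliFactor (.N e) k = localFactor s k := by
    simp [pauliFactor, localFactor, s]
  rw [prod_map_pauliObs, ← tensorOp_one]
  congr 1
  ext1 k
  have hpow : ∀ a ∈ ctxABN e, pauliFactor a k =
      localFactor s k ^ (if a = .N e then 1 else if a = localObs s k then 1 else 0) := by
    intro a ha
    rcases eq_or_ne a (.N e) with rfl | hne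
    · rw [if_pos rfl, pow_one, hN]
    · rw [if_neg hne]
      exact pauliFactor_eq_pow_of_mem_ctxAB ((Finset.mem_insert.1 ha).resolve_left hne) k
  have hsum : ∑ a ∈ ctxABN e, (if a = .N e then 1 else if a = localObs s k then 1 else 0) = 2 := by
    have hrest : ∀ a ∈ ctxAB s, (if a = .N e then 1 else if a = localObs s k then 1 else 0) =
        if a = localObs s k then 1 else 0 :=
      fun a ha => if_neg fun h : a = .N e => N_notMem_ctxAB (h ▸ ha)
    rw [ctxABN, Finset.sum_insert N_notMem_ctxAB, if_pos rfl, Finset.sum_congr rfl hrest,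
      sum_ctxAB_localObs]
  rw [hw.prod_map_eq_pow hpow, hsum, pow_two,
    localFactor_mul_self, Pi.one_apply]

theorem tensorOp_localFactor_mul_mul {i j k : Fin n} (hij : i ≠ j) (hik : i ≠ k) (hjk : j ≠ k) :
    tensorOp (localFactor {i}) * tensorOp (localFactor {j}) * tensorOp (localFactor {k}) =
      -tensorOp (localFactor {i, j, k}) := by
  have hfactor : localFactor {i} * localFactor {j} * localFactor {k} =
      fun l => (if l = j then (-1 : ℂ) else 1) • localFactor {i, j, k} l := by
    ext1 l
    simp only [Pi.mul_apply, localFactor, Finset.mem_insert, Finset.mem_singleton]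
    rcases eq_or_ne l j with rfl | hj
    · simp [hij.symm, hjk, pauliZ_mul_pauliX, mul_assoc, pauliZ_mul_self]
    rcases eq_or_ne l i with rfl | hi
    · simp [hij, hik, mul_assoc, pauliZ_mul_self]
    · simp [hi, hj, pauliZ_mul_self]
  rw [tensorOp_mul, tensorOp_mul, hfactor, tensorOp_smul, Finset.prod_ite_eq',
    if_pos (Finset.mem_univ j)]
  exact neg_one_smul ℂ (tensorOp (localFactor {i, j, k}))

theorem pauliObs_edge_mul_edge {i j k : Fin n} (hij : i ≠ j) (hik : i ≠ k) :
    pauliObs (.N (edge hij)) * pauliObs (.N (edge hik)) =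
      tensorOp (localFactor {j}) * tensorOp (localFactor {k}) := by
  rw [pauliObs_eq_tensorOp, pauliObs_eq_tensorOp, tensorOp_mul, tensorOp_mul]
  congr 1
  ext1 l
  simp only [Pi.mul_apply, pauliFactor, localFactor, mem_edge, Finset.mem_singleton]
  rcases eq_or_ne l i with rfl | hi
  · simp [hij, hik, pauliX_mul_self, pauliZ_mul_self]
  · simp [hi]

end Tensor

/-! ### The complete-graph state -/

section GraphState

variable {n : ℕ}

/-- The sign `(-1) ^ b` of a bit `b`. -/
def bitSign (b : Fin 2) : ℂ := if b = 1 then -1 else 1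

/-- The bit string `x` with its `i`-th bit flipped. -/
def flipBit (x : Fin n → Fin 2) (i : Fin n) : Fin n → Fin 2 := Function.update x i (x i + 1)

theorem pauliX_apply (a b : Fin 2) : pauliX a b = if b = a + 1 then 1 else 0 := by
  fin_cases a <;> fin_cases b <;> simp [pauliX]

theorem pauliZ_apply (a b : Fin 2) : pauliZ a b = if b = a then bitSign a else 0 := by
  fin_cases a <;> fin_cases b <;> simp [pauliZ, bitSign]

theorem localFactor_singleton_apply (i k : Fin n) (x y : Fin n → Fin 2) :
    localFactor {i} k (x k) (y k) =
      if y k = flipBit x i k then if k = i then 1 else bitSign (x k) else 0 := by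
  rcases eq_or_ne k i with rfl | hk
  · simp [localFactor, flipBit, pauliX_apply]
  · simp [localFactor, flipBit, pauliZ_apply, hk]

theorem tensorOp_localFactor_singleton_apply (i : Fin n) (φ : Qubits n) (x : Fin n → Fin 2) :
    tensorOp (localFactor {i}) φ x =
      (∏ k, if k = i then 1 else bitSign (x k)) * φ (flipBit x i) := by
  rw [tensorOp, Matrix.ofLp_toEuclideanCLM, Matrix.mulVec, dotProduct,
    Finset.sum_eq_single (flipBit x i)]
  · simp only [Matrix.of_apply, localFactor_singleton_apply, if_true]
  · intro y _ hy
    obtain ⟨k, hk⟩ := Function.ne_iff.1 hy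
    rw [Matrix.of_apply, Finset.prod_eq_zero (Finset.mem_univ k), zero_mul]
    rw [localFactor_singleton_apply, if_neg hk]
  · simp

/-- `(-1) ^ #{i < j : x_i = x_j = 1}`. -/
def pairSign (x : Fin n → Fin 2) : ℂ :=
  ∏ i : Fin n, ∏ j ∈ Finset.Ioi i, if x i = 1 ∧ x j = 1 then (-1 : ℂ) else 1

theorem completeGraphState_apply (x : Fin n → Fin 2) :
    completeGraphState n x = ((Real.sqrt 2 : ℂ)⁻¹) ^ n * pairSign x := rfl

theorem pairSign_mul_self (x : Fin n → Fin 2) : pairSign x * pairSign x = 1 := by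
  simp only [pairSign, ← Finset.prod_mul_distrib]
  refine Finset.prod_eq_one fun i _ => Finset.prod_eq_one fun j _ => ?_
  split_ifs <;> simp

theorem prod_prod_Ioi_incident {ι R : Type*} [Fintype ι] [LinearOrder ι]
    [LocallyFiniteOrderTop ι] [CommMonoid R] (i : ι) (f : ι → R) :
    ∏ a, ∏ b ∈ Finset.Ioi a, (if a = i then f b else if b = i then f a else 1) =
      ∏ k, if k = i then 1 else f k := by
  have hrow (a : ι) : ∏ b ∈ Finset.Ioi a, (if a = i then f b else if b = i then f a else 1) =
      (if a < i then f a else 1) * if a = i then ∏ b ∈ Finset.Ioi i, f b else 1 := by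
    rcases eq_or_ne a i with rfl | ha
    · simp
    · simp [ha]
  have hIoi : ∏ b ∈ Finset.Ioi i, f b = ∏ b, if i < b then f b else 1 := by
    rw [← Finset.prod_filter]
    congr 1
    ext
    simp
  rw [Finset.prod_congr rfl fun a _ => hrow a, Finset.prod_mul_distrib, Finset.prod_ite_eq',
    if_pos (Finset.mem_univ i), hIoi, ← Finset.prod_mul_distrib]
  refine Finset.prod_congr rfl fun k _ => ?_
  rcases lt_trichotomy k i with h | rfl | h
  · simp [h, h.ne, h.not_gt]
  · simp
  · simp [h, h.ne', h.not_gt]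

theorem pairSign_factor_mul_flipBit (x : Fin n → Fin 2) (i : Fin n) {a b : Fin n} (hab : a ≠ b) :
    ((if x a = 1 ∧ x b = 1 then (-1 : ℂ) else 1) *
        if flipBit x i a = 1 ∧ flipBit x i b = 1 then (-1 : ℂ) else 1) =
      if a = i then bitSign (x b) else if b = i then bitSign (x a) else 1 := by
  have hbit (p q : Fin 2) : ((if p = 1 ∧ q = 1 then (-1 : ℂ) else 1) *
      if p + 1 = 1 ∧ q = 1 then (-1 : ℂ) else 1) = bitSign q := by
    fin_cases p <;> fin_cases q <;> simp [bitSign]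
  rcases eq_or_ne a i with rfl | ha
  · simpa [flipBit, hab.symm] using hbit (x a) (x b)
  rcases eq_or_ne b i with rfl | hb
  · simpa [flipBit, hab, and_comm] using hbit (x b) (x a)
  · simp only [flipBit, ha, hb, if_false, ne_eq, not_false_eq_true, Function.update_of_ne]
    split_ifs <;> simp

theorem pairSign_mul_pairSign_flipBit (x : Fin n → Fin 2) (i : Fin n) :
    pairSign x * pairSign (flipBit x i) = ∏ k, if k = i then 1 else bitSign (x k) := by
  rw [← prod_prod_Ioi_incident]
  simp only [pairSign, ← Finset.prod_mul_distrib]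
  exact Finset.prod_congr rfl fun a _ => Finset.prod_congr rfl fun b hb =>
    pairSign_factor_mul_flipBit x i (Finset.mem_Ioi.1 hb).ne

theorem isGraphState_top_iff {φ : Qubits n} :
    IsGraphState ⊤ φ ↔ ‖φ‖ = 1 ∧ ∀ i, tensorOp (localFactor {i}) φ = φ := by
  refine and_congr_right fun _ => forall_congr' fun i => ?_
  congr! 3
  ext1 k
  rcases eq_or_ne k i with rfl | hk
  · simp [localFactor]
  · simp [localFactor, hk, hk.symm]

theorem tensorOp_localFactor_singleton_completeGraphState (i : Fin n) :
    tensorOp (localFactor {i}) (completeGraphState n) = completeGraphState n := by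
  ext x
  rw [tensorOp_localFactor_singleton_apply, completeGraphState_apply, completeGraphState_apply,
    ← pairSign_mul_pairSign_flipBit]
  linear_combination ((Real.sqrt 2 : ℂ)⁻¹) ^ n * pairSign x * pairSign_mul_self (flipBit x i)

theorem norm_completeGraphState (n : ℕ) : ‖completeGraphState n‖ = 1 := by
  have hcoord (x : Fin n → Fin 2) : ‖completeGraphState n x‖ ^ 2 = (2⁻¹ : ℝ) ^ n := by
    have hsign : ‖pairSign x‖ = 1 := by
      rcases mul_self_eq_one_iff.1 (pairSign_mul_self x) with h | h <;> simp [h]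
    rw [completeGraphState_apply, norm_mul, hsign, mul_one, norm_pow, ← pow_mul, mul_comm, pow_mul,
      norm_inv, Complex.norm_real, Real.norm_of_nonneg (Real.sqrt_nonneg 2), inv_pow,
      Real.sq_sqrt zero_le_two]
  rw [EuclideanSpace.norm_eq, Finset.sum_congr rfl fun x _ => hcoord x]
  simp

theorem isGraphState_completeGraphState : IsGraphState ⊤ (completeGraphState n) :=
  isGraphState_top_iff.2
    ⟨norm_completeGraphState n, tensorOp_localFactor_singleton_completeGraphState⟩

theorem eq_of_flipBit_invariant {β : Type*} {r : (Fin n → Fin 2) → β}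
    (hr : ∀ x i, r (flipBit x i) = r x) (x : Fin n → Fin 2) : r x = r 0 := by
  have hupdate (x : Fin n → Fin 2) (i : Fin n) (b : Fin 2) : r (Function.update x i b) = r x := by
    rcases eq_or_ne b (x i) with rfl | hb
    · rw [Function.update_eq_self]
    · rw [show b = x i + 1 by omega]
      exact hr x i
  have hpiecewise (s : Finset (Fin n)) : r (s.piecewise x 0) = r 0 := by
    induction s using Finset.induction_on with
    | empty => rw [Finset.piecewise_empty]
    | insert i s _ ih => rw [Finset.piecewise_insert, hupdate, ih]
  simpa using hpiecewise Finset.univ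

theorem pairSign_flipBit_mul_apply {φ : Qubits n} {i : Fin n}
    (hφ : tensorOp (localFactor {i}) φ = φ) (x : Fin n → Fin 2) :
    pairSign (flipBit x i) * φ (flipBit x i) = pairSign x * φ x := by
  have hx := tensorOp_localFactor_singleton_apply i φ x
  rw [hφ, ← pairSign_mul_pairSign_flipBit] at hx
  rw [hx]
  linear_combination -pairSign (flipBit x i) * φ (flipBit x i) * pairSign_mul_self x

theorem exists_phase_of_isGraphState {φ : Qubits n} (hφ : IsGraphState ⊤ φ) :
    ∃ z : ℂ, ‖z‖ = 1 ∧ φ = z • completeGraphState n := by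
  obtain ⟨hnorm, hstab⟩ := isGraphState_top_iff.1 hφ
  have hconst (x : Fin n → Fin 2) : pairSign x * φ x = pairSign 0 * φ 0 :=
    eq_of_flipBit_invariant (r := fun x => pairSign x * φ x)
      (fun x i => pairSign_flipBit_mul_apply (hstab i) x) x
  let z : ℂ := (((Real.sqrt 2 : ℂ)⁻¹) ^ n)⁻¹ * (pairSign (n := n) 0 * φ 0)
  have hz : φ = z • completeGraphState n := by
    ext x
    calc φ x = pairSign x * (pairSign x * φ x) := by rw [← mul_assoc, pairSign_mul_self, one_mul]
      _ = z * (((Real.sqrt 2 : ℂ)⁻¹) ^ n * pairSign x) := by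
        rw [hconst]
        simp only [z]
        field_simp
  refine ⟨z, ?_, hz⟩
  rwa [hz, norm_smul, norm_completeGraphState, mul_one] at hnorm

end GraphState

/-! ### The reference experiment -/

section Reference

variable {n : ℕ}

theorem isRealization_pauliObs : IsRealization (completeGraphState n) (pauliObs (n := n)) :=
  ⟨norm_completeGraphState n, isSelfAdjoint_pauliObs, pauliObs_mul_self⟩

theorem wordsAct_pauliObs_triple {t : Finset (Fin n)} (ht : t.card = 3) :
    WordsAct (completeGraphState n) pauliObs (ctxAB t) (-1) := by
  intro w hw
  obtain ⟨i, j, k, hij, hik, hjk, rfl⟩ := Finset.card_eq_three.1 ht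
  rw [prod_map_pauliObs_ctxAB hw, ← neg_neg (tensorOp _),
    ← tensorOp_localFactor_mul_mul hij hik hjk]
  simp [tensorOp_localFactor_singleton_completeGraphState]

theorem pauliObs_edge_edge_completeGraphState {i j k : Fin n} (hij : i ≠ j) (hik : i ≠ k) :
    pauliObs (.N (edge hij)) (pauliObs (.N (edge hik)) (completeGraphState n)) =
      completeGraphState n := by
  rw [← mul_apply_eq_comp, pauliObs_edge_mul_edge, mul_apply_eq_comp,
    tensorOp_localFactor_singleton_completeGraphState,
    tensorOp_localFactor_singleton_completeGraphState]

theorem wordsAct_pauliObs_edges {t : Finset (Fin n)} (ht : t.card = 3) {i : Fin n} (hi : i ∈ t) :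
    WordsAct (completeGraphState n) pauliObs (ctxNN t i) 1 := by
  intro w hw
  obtain ⟨j, k, hjk, hpair⟩ := Finset.card_eq_two.1
    (show (t.erase i).card = 2 by rw [Finset.card_erase_of_mem hi, ht])
  have hij : i ≠ j := (Finset.ne_of_mem_erase (by simp [hpair] : j ∈ t.erase i)).symm
  have hik : i ≠ k := (Finset.ne_of_mem_erase (by simp [hpair] : k ∈ t.erase i)).symm
  have hne : edge hij ≠ edge hik := by simp [edge_eq_edge_iff, hjk, hik]
  rw [← Finset.insert_erase hi, hpair, ctxNN_eq_pair hij hik] at hw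
  have hperm : [Obs.N (edge hij), Obs.N (edge hik)].Perm w :=
    List.perm_of_nodup_nodup_toFinset_eq (by simpa using hne) hw.1 (by simp [hw.2])
  rcases List.pair_perm.1 hperm with rfl | rfl <;>
    simp [pauliObs_edge_edge_completeGraphState]

theorem isExtremal_pauliObs : IsExtremal (completeGraphState n) (pauliObs (n := n)) where
  toIsRealization := isRealization_pauliObs
  ABN _ w hw := by rw [prod_map_pauliObs_ctxABN hw, one_smul, one_apply_eq_self]
  AB_singleton i w hw := by
    rw [prod_map_pauliObs_ctxAB hw, tensorOp_localFactor_singleton_completeGraphState, one_smul]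
  AB_triple _ := wordsAct_pauliObs_triple
  NN _ ht _ := wordsAct_pauliObs_edges ht

theorem invSubspace_pauliObs_eq_top (hn : 3 ≤ n) :
    invSubspace (completeGraphState n) pauliObs = ⊤ :=
  Submodule.eq_top_of_finrank_eq <| by
    rw [isExtremal_pauliObs.finrank_invSubspace hn, finrank_euclideanSpace]
    simp

end Reference

end TemporalSelfTest

end

theorem theorem2 (n : ℕ) (hn : 3 ≤ n) (π : ∀ c : Finset (Obs n), PermScheme c) :
    -- the classical bound, the quantum bound, and the gap between them
    IsGreatest (Set.range (classicalValue n)) (etaC n) ∧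
    etaC n < etaQ n ∧
    (∀ (H : Type*) [NormedAddCommGroup H] [InnerProductSpace ℂ H] [CompleteSpace H]
      (ψ : H) (M : Obs n → H →L[ℂ] H), IsRealization ψ M → temporalValue π ψ M ≤ etaQ n) ∧
    -- the complete-graph state and its characterization by stabilizers
    IsGraphState ⊤ (completeGraphState n) ∧
    (∀ φ : Qubits n, IsGraphState ⊤ φ → ∃ z : ℂ, ‖z‖ = 1 ∧ φ = z • completeGraphState n) ∧
    -- the reference experiment is a realization and attains the quantum bound
    IsRealization (completeGraphState n) (pauliObs (n := n)) ∧
    temporalValue π (completeGraphState n) (pauliObs (n := n)) = etaQ n ∧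
    -- self-testing
    (∀ (H : Type*) [NormedAddCommGroup H] [InnerProductSpace ℂ H] [CompleteSpace H]
      (ψ : H) (M : Obs n → H →L[ℂ] H), IsRealization ψ M → temporalValue π ψ M = etaQ n →
      (∀ a, ∀ v ∈ invSubspace ψ M, M a v ∈ invSubspace ψ M) ∧
      Module.finrank ℂ (invSubspace ψ M) = 2 ^ n ∧
      (2 ^ n : Cardinal) ≤ Module.rank ℂ H ∧
      ∃ U : invSubspace ψ M ≃ₗᵢ[ℂ] Qubits n,
        (∀ a, ∀ φ : Qubits n,
          U ((invSubspace ψ M).orthogonalProjectionOnto (M a ((invSubspace ψ M).subtypeL (U.symm φ)))) =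
            pauliObs a φ) ∧
        U ((invSubspace ψ M).orthogonalProjectionOnto ψ) = completeGraphState n ∧
        ψ ∈ invSubspace ψ M) := by
  refine ⟨isGreatest_classicalValue (by omega), etaC_lt_etaQ hn,
    fun H _ _ _ ψ M h => h.temporalValue_le_etaQ π (by omega),
    isGraphState_completeGraphState, fun φ hφ => exists_phase_of_isGraphState hφ,
    isRealization_pauliObs, (isRealization_pauliObs.temporalValue_eq_etaQ_iff π hn).2
      isExtremal_pauliObs, fun H _ _ _ ψ M h hmax => ?_⟩
  have hE : IsExtremal ψ M := (h.temporalValue_eq_etaQ_iff π hn).1 hmax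
  obtain ⟨U, hobs, hstate⟩ := hE.exists_unitary_of_invSubspace_eq_top isExtremal_pauliObs hn
    (invSubspace_pauliObs_eq_top hn)
  exact ⟨fun a v => hE.apply_mem_invSubspace hn a, hE.finrank_invSubspace hn,
    hE.two_pow_le_rank hn, U, hobs, hstate, state_mem_invSubspace⟩
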